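/- Let $\mathbb{k}$ be $\mathbb{R}$ or $\mathbb{C}$ and let $g\ge 1$ be an integer. Let $W_{gc}$ be the set of families $(H^{j}_{k})$, with $j\ge 2g+1$ and $k\ge 1-2g$ odd integers, of elements of $\mathbb{k}$ such that for all $j,k\ge g$ $$H^{2j+1}_{2(l+m)+1}-H^{2(j+m)+1}_{2l+1}-\sum_{s=-g}^{m-g-1}H^{2j+1}_{2s+1}H^{2(m-s)-1}_{2l+1}=0\qquad(m\ge 0,\ l\ge -g),$$ $$H^{2j+1}_{2(l+k)+1}+H^{2k+1}_{2(l+j)+1}+\sum_{\substack{s,r\ge -g\\ s+r=l-1}}H^{2j+1}_{2s+1}H^{2k+1}_{2r+1}=0\qquad(l\ge 1).$$ For $H\in W_{gc}$ put $\lambda=z^2$ and $p_{2j+1}=z^{2j+1}+\sum_{s\ge -g}H^{2j+1}_{2s+1}z^{-(2s+1)}$ for $j\ge g$ (Laurent series in $1/z$). Put $v_i=H^{2g+1}_i$ for odd $i$ with $1-2g\le i\le 2g+1$, and let $u=u(v)=(u_0,\dots,u_{2g})$ be given by $$u_s=2v_{2(g-s)+1}+\sum_{i+i'=-2s}v_iv_{i'},\qquad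 s=0,\dots,2g ,$$ where the sum is over ordered pairs of odd integers $i,i'\in[1-2g,2g+1]$. There are polynomials $F_{i,k}$ in the $2g+1$ variables $v$ ($0\le k\le 2g$) and $(2g+1)\times(2g+1)$ matrices $V^{(k)}$ ($1\le k\le 2g$) of polynomials in the $2g+1$ variables $u$ such that the following hold. 1. The map $H\mapsto v$ is a bijection of $W_{gc}$ onto $\mathbb{k}^{2g+1}$, and $H^{2(g+k)+1}_{i}=F_{i,k}(v)$ on $W_{gc}$ for $0\le k\le 2g$ and $1-2g\le i\le 2g+1$. Moreover $F_{i,1}=v_{i+2}-v_{1-2g}v_i$ for $i\le 2g-1$, and $F_{2g+1,1}=-\tfrac12\sum_{i+i'=2}v_iv_{i'}-v_{1-2g}v_{2g+1}$, the sum being again over ordered pairs of odd integers $i,i'\in[1-2g,2g+1]$. 2. For every $H\in W_{gc}$ one has $p_{2g+1}^2=\lambda^{2g+1}+\sum_{k=0}^{2g}u_k\lambda^k$, and for every $j\ge g$ one has $p_{2j+1}=\alpha_j(\lambda)p_{2g+1}$ with a monic polynomial $\alpha_j$ of degree $j-g$. The span of all $\lambda^m$ ($m\ge0$) and $p_{2j+1}$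 ($j\ge g$) is the $\mathbb{k}$-algebra generated by $\lambda$ and $p_{2g+1}$, and this algebra is isomorphic, by $\lambda\mapsto\lambda$, $p\mapsto p_{2g+1}$, to the coordinate ring $\mathbb{k}[\lambda,p]/\big(p^2-\lambda^{2g+1}-\sum_k u_k\lambda^k\big)$. 3. Let $U$ be an open subset of the space $\mathbb{k}^{2g+1}$ with coordinates $x_{2g+1},x_{2g+3},\dots,x_{6g+1}$, and let $x\mapsto H(x)\in W_{gc}$ be a family over $U$ all of whose entries are $C^1$ over $\mathbb{k}$ (holomorphic if $\mathbb{k}=\mathbb{C}$). The following are equivalent: (a) the $2g+1$ one-forms $\omega_i=\sum_{k=0}^{2g}H^{2(g+k)+1}_i\,dx_{2(g+k)+1}$, $i=1-2g,3-2g,\dots,2g+1$, are closed on $U$ (the family lies in $W_{gc}^I$); (b) near every point of $U$ there are $C^2$ functions $S_{1-2g},S_{3-2g},\dots,S_{2g+1}$ with $\omega_i=dS_i$ for all $i$, and they satisfy the $2g$ Hamilton–Jacobi type systems $$\frac{\partial S_i}{\partial x_{2(g+k)+1}}=F_{i,k}\Big(\frac{\partial S_{1-2g}}{\partial x_{2g+1}},\dots,\frac{\partial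 S_{2g+1}}{\partial x_{2g+1}}\Big),\qquad k=1,\dots,2g;$$ (c) on $U$, $v$ satisfies the $2g$ systems of conservation laws $\dfrac{\partial v_i}{\partial x_{2(g+k)+1}}=\dfrac{\partial}{\partial x_{2g+1}}F_{i,k}(v)$, $k=1,\dots,2g$; (d) on $U$, the curve coefficients $u=u(v)$ satisfy the $2g$ systems of hydrodynamic type $\dfrac{\partial u_j}{\partial x_{2(g+k)+1}}=\sum_{l=0}^{2g}V^{(k)}_{jl}(u)\dfrac{\partial u_l}{\partial x_{2g+1}}$, $k=1,\dots,2g$. Conversely, every $C^2$ solution $(S_i)$ of all the systems in (b) on an open set $U$ arises in this way: there is a $C^1$ family over $U$ with values in $W_{gc}$ and with closed forms $\omega_i=dS_i$. Moreover, for every $C^1$ map $v:U\to\mathbb{k}^{2g+1}$ and each single $k\in\{1,\dots,2g\}$, the $k$-th system in (c) for $v$ is equivalent to the $k$-th system in (d) for $u(v)$. 4. The first system in (d) is the dispersionless coupled KdV system $$\frac{\partial u_j}{\partial x_{2g+3}}=\frac{\partial u_{j-1}}{\partial x_{2g+1}}-\frac12u_{2g}\frac{\partial u_j}{\partial x_{2g+1}}-u_j\frac{\partial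 u_{2g}}{\partial x_{2g+1}},\qquad j=0,\dots,2g,\quad u_{-1}:=0 .$$ 5. The $2g$ systems commute pairwise, in each of the three forms (b), (c), (d): regarding the $k$-th and the $l$-th system ($1\le k,l\le 2g$) as evolutionary systems in the spatial variable $x_{2g+1}$, the two mixed derivatives of the unknown functions in $x_{2(g+k)+1}$ and $x_{2(g+l)+1}$ computed from the two systems coincide identically, i.e. the commutator of the two evolutionary vector fields vanishes at every $C^2$ function of the spatial variable. -/

import Mathlib

/-- The set `W_{gc}` of tables of coefficients.  The number `H j s` stands for the coefficient
with upper index `2(g+j)+1` and lower index `2(s-g)+1`, so that `j = 0, 1, 2, …` corresponds to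
upper indices `2g+1, 2g+3, …` and `s = 0, 1, 2, …` to lower indices `1-2g, 3-2g, …`.
The two families of quadratic equations are the associativity conditions; they are the
vanishing of the obstructions to `λ^k p_j` and `p_j p_k` lying in the span of the basis. -/
def Wgc (𝕜 : Type*) [Field 𝕜] (g : ℕ) : Set (ℕ → ℕ → 𝕜) :=
  {H | (∀ j k l : ℕ,
          H j (l + k) - H (j + k) l - ∑ i ∈ Finset.range k, H j i * H (k - 1 - i) l = 0) ∧
       (∀ j k m : ℕ,
          H j (2 * g + k + (m + 1)) + H k (2 * g + j + (m + 1))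
            + ∑ ab ∈ Finset.HasAntidiagonal.antidiagonal (2 * g + m), H j ab.1 * H k ab.2 = 0)}

/-- Laurent series are written in the local parameter `t = 1/z`; this is `λ = z ^ 2 = t ^ (-2)`. -/
noncomputable def lamSeries (𝕜 : Type*) [Field 𝕜] : LaurentSeries 𝕜 :=
  HahnSeries.single (-2 : ℤ) 1

/-- The basis series of order `2(g+j)+1`,
`z^(2(g+j)+1) + ∑_{s ≥ 0} (H j s) z^(-(2(s-g)+1))`, as a Laurent series in `t = 1/z`. -/
noncomputable def pSeries {𝕜 : Type*} [Field 𝕜] (g : ℕ) (H : ℕ → ℕ → 𝕜) (j : ℕ) :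
    LaurentSeries 𝕜 :=
  HahnSeries.single (-(2 * ((g : ℤ) + j) + 1)) 1
    + HahnSeries.single (1 - 2 * (g : ℤ)) 1
        * HahnSeries.ofPowerSeries ℤ 𝕜
            (PowerSeries.mk fun n => if Even n then H j (n / 2) else 0)

/-- The point of the Grassmannian: the span of all `λ^m` and all basis series of odd order. -/
noncomputable def pointSpace {𝕜 : Type*} [Field 𝕜] (g : ℕ) (H : ℕ → ℕ → 𝕜) :
    Submodule 𝕜 (LaurentSeries 𝕜) :=
  Submodule.span 𝕜
    (Set.range (fun m : ℕ => lamSeries 𝕜 ^ m) ∪ Set.range (fun j : ℕ => pSeries g H j))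

/-- The coordinates `v_s = H^{2g+1}_{2(s-g)+1}`, `s = 0, …, 2g`, of a table. -/
def baseCoords {𝕜 : Type*} (g : ℕ) (H : ℕ → ℕ → 𝕜) : Fin (2 * g + 1) → 𝕜 :=
  fun s => H 0 s

/-- The coefficients `u_0, …, u_{2g}` of the curve as functions of `v`:
`u_s = 2 v_{2g-s} + ∑_{a+b = 2g-1-s} v_a v_b`. -/
def curveCoeff {𝕜 : Type*} [Field 𝕜] (g : ℕ) (v : Fin (2 * g + 1) → 𝕜) :
    Fin (2 * g + 1) → 𝕜 :=
  fun s => 2 * v (Fin.rev s)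
    + ∑ a : Fin (2 * g + 1), ∑ b : Fin (2 * g + 1),
        if (a : ℕ) + b + 1 + s = 2 * g then v a * v b else 0

/-- The polynomial `λ^(2g+1) + ∑ u_k λ^k`. -/
noncomputable def curvePoly {𝕜 : Type*} [Field 𝕜] (g : ℕ) (u : Fin (2 * g + 1) → 𝕜) :
    Polynomial 𝕜 :=
  Polynomial.X ^ (2 * g + 1) + ∑ k : Fin (2 * g + 1), Polynomial.C (u k) * Polynomial.X ^ (k : ℕ)

/-- The coordinate ring `𝕜[λ][p] / (p^2 - (λ^(2g+1) + ∑ u_k λ^k))` of the affine curve. -/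
abbrev CurveRing {𝕜 : Type*} [Field 𝕜] (g : ℕ) (u : Fin (2 * g + 1) → 𝕜) : Type _ :=
  AdjoinRoot (Polynomial.X ^ 2 - Polynomial.C (curvePoly g u) : Polynomial (Polynomial 𝕜))

/-- The partial derivative with respect to the `i`-th coordinate. -/
noncomputable def partialD {𝕜 ι : Type*} [RCLike 𝕜] [Fintype ι] [DecidableEq ι] (i : ι)
    (f : (ι → 𝕜) → 𝕜) (x : ι → 𝕜) : 𝕜 :=
  fderiv 𝕜 f x (Pi.single i 1)

/-- A continuously differentiable family of points of `W_{gc}` over an open set `U` of the space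
of the variables `x_{2g+1}, x_{2g+3}, …, x_{6g+1}` (the `k`-th coordinate is `x_{2(g+k)+1}`). -/
structure IsWgcFamily {𝕜 : Type*} [RCLike 𝕜] (g : ℕ) (U : Set (Fin (2 * g + 1) → 𝕜))
    (H : (Fin (2 * g + 1) → 𝕜) → ℕ → ℕ → 𝕜) : Prop where
  mem : ∀ x ∈ U, H x ∈ Wgc 𝕜 g
  contDiffOn : ∀ j s : ℕ, ContDiffOn 𝕜 1 (fun x => H x j s) U

/-- The one-form `ω_i = ∑_k H^{2(g+k)+1}_i dx_{2(g+k)+1}`, for the lower index `2(i-g)+1`. -/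
noncomputable def omegaForm {𝕜 : Type*} [RCLike 𝕜] (g : ℕ)
    (H : (Fin (2 * g + 1) → 𝕜) → ℕ → ℕ → 𝕜) (i : Fin (2 * g + 1)) :
    (Fin (2 * g + 1) → 𝕜) → ((Fin (2 * g + 1) → 𝕜) →L[𝕜] 𝕜) :=
  fun x => ∑ k : Fin (2 * g + 1),
    H x k i • (ContinuousLinearMap.proj k : (Fin (2 * g + 1) → 𝕜) →L[𝕜] 𝕜)

/-- Closedness `dω = 0` on `U` of a (differentiable) one-form. -/
def IsClosedFormOn {𝕜 E : Type*} [RCLike 𝕜] [NormedAddCommGroup E] [NormedSpace 𝕜 E]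
    (ω : E → (E →L[𝕜] 𝕜)) (U : Set E) : Prop :=
  ∀ x ∈ U, ∀ a b : E, fderiv 𝕜 ω x a b - fderiv 𝕜 ω x b a = 0

/-- A family belongs to the subvariety `W_{gc}^I` if the `2g+1` one-forms `ω_i` are closed. -/
def IsIntegrableFamily {𝕜 : Type*} [RCLike 𝕜] (g : ℕ) (U : Set (Fin (2 * g + 1) → 𝕜))
    (H : (Fin (2 * g + 1) → 𝕜) → ℕ → ℕ → 𝕜) : Prop :=
  ∀ i : Fin (2 * g + 1), IsClosedFormOn (omegaForm g H i) U

section Systems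

variable {𝕜 : Type*} [RCLike 𝕜] {n : ℕ}

/-- The system of Hamilton–Jacobi type `∂S_i/∂x_k = F_i (∂S_0/∂x_0, …, ∂S_n/∂x_0)` on `U`. -/
def SolvesHJ (k : Fin (n + 1)) (F : Fin (n + 1) → MvPolynomial (Fin (n + 1)) 𝕜)
    (U : Set (Fin (n + 1) → 𝕜)) (S : Fin (n + 1) → (Fin (n + 1) → 𝕜) → 𝕜) : Prop :=
  ∀ x ∈ U, ∀ i, partialD k (S i) x = MvPolynomial.eval (fun l => partialD 0 (S l) x) (F i)

/-- The system of conservation laws `∂v_i/∂x_k = ∂/∂x_0 (F_i(v))` on `U`. -/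
def SolvesConsLaw (k : Fin (n + 1)) (F : Fin (n + 1) → MvPolynomial (Fin (n + 1)) 𝕜)
    (U : Set (Fin (n + 1) → 𝕜)) (v : (Fin (n + 1) → 𝕜) → Fin (n + 1) → 𝕜) : Prop :=
  ∀ x ∈ U, ∀ i, partialD k (fun y => v y i) x
    = partialD 0 (fun y => MvPolynomial.eval (v y) (F i)) x

/-- The system of hydrodynamical type `∂u_j/∂x_k = ∑_l V_{jl}(u) ∂u_l/∂x_0` on `U`. -/
def SolvesHydro (k : Fin (n + 1))
    (V : Matrix (Fin (n + 1)) (Fin (n + 1)) (MvPolynomial (Fin (n + 1)) 𝕜))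
    (U : Set (Fin (n + 1) → 𝕜)) (u : (Fin (n + 1) → 𝕜) → Fin (n + 1) → 𝕜) : Prop :=
  ∀ x ∈ U, ∀ j, partialD k (fun y => u y j) x
    = ∑ l, MvPolynomial.eval (u x) (V j l) * partialD 0 (fun y => u y l) x

/-- Right-hand side of the evolutionary system `∂S/∂t = F(S_x)`, as a function of `(S, S_x)`. -/
noncomputable def hjRHS (F : Fin (n + 1) → MvPolynomial (Fin (n + 1)) 𝕜) :
    (Fin (n + 1) → 𝕜) × (Fin (n + 1) → 𝕜) → (Fin (n + 1) → 𝕜) :=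
  fun q i => MvPolynomial.eval q.2 (F i)

/-- Right-hand side of `∂v/∂t = ∂F(v)/∂x = F'(v) v_x`, as a function of `(v, v_x)`. -/
noncomputable def consRHS (F : Fin (n + 1) → MvPolynomial (Fin (n + 1)) 𝕜) :
    (Fin (n + 1) → 𝕜) × (Fin (n + 1) → 𝕜) → (Fin (n + 1) → 𝕜) :=
  fun q i => ∑ m, MvPolynomial.eval q.1 (MvPolynomial.pderiv m (F i)) * q.2 m

/-- Right-hand side of `∂u/∂t = V(u) u_x`, as a function of `(u, u_x)`. -/
noncomputable def hydroRHS
    (V : Matrix (Fin (n + 1)) (Fin (n + 1)) (MvPolynomial (Fin (n + 1)) 𝕜)) :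
    (Fin (n + 1) → 𝕜) × (Fin (n + 1) → 𝕜) → (Fin (n + 1) → 𝕜) :=
  fun q j => ∑ l, MvPolynomial.eval q.1 (V j l) * q.2 l

/-- The linearization, at the function `q`, of the differential expression `K(q, q_x)`, applied
to the variation `φ`. -/
noncomputable def linearizedRHS
    (K : (Fin (n + 1) → 𝕜) × (Fin (n + 1) → 𝕜) → (Fin (n + 1) → 𝕜))
    (q φ : 𝕜 → Fin (n + 1) → 𝕜) (y : 𝕜) : Fin (n + 1) → 𝕜 :=
  fderiv 𝕜 K (q y, deriv q y) (φ y, deriv φ y)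

/-- The evolutionary systems `∂q/∂t = K(q, q_x)` and `∂q/∂τ = L(q, q_x)` commute: the two mixed
derivatives of `q` in `t` and `τ` computed from the systems coincide identically, i.e. the
commutator of the two evolutionary vector fields vanishes at every function `q`. -/
def SystemsCommute
    (K L : (Fin (n + 1) → 𝕜) × (Fin (n + 1) → 𝕜) → (Fin (n + 1) → 𝕜)) : Prop :=
  ∀ (I : Set 𝕜) (q : 𝕜 → Fin (n + 1) → 𝕜), IsOpen I → ContDiffOn 𝕜 2 q I → ∀ y ∈ I,
    linearizedRHS K q (fun s => L (q s, deriv q s)) y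
      = linearizedRHS L q (fun s => K (q s, deriv q s)) y

end Systems

/-!
Write `X = λ⁻¹`.  Dividing the basis series `p_{2(g+j)+1}` by `z^(2g+1)` gives series
`h_j = λ^j + O(X)` in `λ` alone.  The linear relations of `W_{gc}` say that `h_j` is a
polynomial in `λ` times `h = h_0`, hence `h_j = α_j h` with `α_j` the polynomial part of `λ^j w`,
`w = 1 / h`; the quadratic relations say that `h²` is a polynomial of degree at most `2g + 1` in
`X`.  A point of `W_{gc}` is thus the square root `h` of a polynomial `1 + ∑ u_s X^(2g+1-s)`, and
such a root is determined, by a recursion with polynomial coefficients, by its first `2g + 1`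
coefficients `v`, as well as by `u` (`eq_tableOf_of_mem_Wgc`, `tableOf_rootSeq_mem`, `curve_root`,
`root_curve`).  This gives the polynomials `F k`, the polynomial automorphism `v ↦ u`, and the
matrices `V k`, which are the Jacobians of `F k` written in the coordinates `u`.

The closedness equations that involve `x_{2g+1}` are the conservation laws, which are the truncation
of `∂_k h = ∂_x (α_k h)`.  Multiplying by `2h` turns the full equation into one about the
polynomials `h²` and `α_k`, so that the truncated equation implies the full one
(`PowerSeries.flow_of_trunc_flow`); equivalently `∂_k w = α_k w' - α_k' w`.  Taking polynomial parts
yields the zero-curvature equation `∂_k α_l - ∂_l α_k = α_k α_l' - α_l α_k'`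
(`PowerSeries.trunc_zero_curvature`), and then `∂_k (α_l h) = ∂_l (α_k h)`
(`PowerSeries.flows_symmetric`).  Over the polynomial ring in `v`, with derivations in place of the
flows, this states that the Jacobians of `F k` and `F l` commute (`fderiv_tablePoly_comm`).

Everything else follows from this commutation.  It gives the remaining closedness equations from the
conservation laws (`IsWgcFamily.isIntegrableFamily_iff`), the Poincaré lemma provides the functions
`S_i`, and the commutators of the Hamilton–Jacobi systems and of the conservation laws are
`[F k', F l'] q_xx` and the derivative of `[F k', F l'] q_x`.  The statements about `u` are obtained
by the chain rule from the change of variables `v ↦ u` (`SystemsCommute.transport`).  The algebra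
generated by `λ` and `p_{2g+1}` has no relation besides `p² = P(λ)`, because `P` has odd degree.
-/

/-! ### Power series of bounded degree and coefficientwise derivations -/

namespace PowerSeries

variable {R : Type*} [CommRing R]

/-- The power series `f` is a polynomial of degree at most `N`. -/
def DegLE (N : ℕ) (f : PowerSeries R) : Prop :=
  ∀ n, N < n → coeff n f = 0

namespace DegLE

variable {f g : PowerSeries R} {M N : ℕ}

lemma mono (hf : DegLE M f) (h : M ≤ N) : DegLE N f :=
  fun n hn => hf n (h.trans_lt hn)

lemma add (hf : DegLE N f) (hg : DegLE N g) : DegLE N (f + g) := fun n hn => by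
  rw [map_add, hf n hn, hg n hn, add_zero]

lemma sub (hf : DegLE N f) (hg : DegLE N g) : DegLE N (f - g) := fun n hn => by
  rw [map_sub, hf n hn, hg n hn, sub_zero]

lemma mul (hf : DegLE M f) (hg : DegLE N g) : DegLE (M + N) (f * g) := fun n hn => by
  rw [coeff_mul]
  refine Finset.sum_eq_zero fun p hp => ?_
  rw [Finset.HasAntidiagonal.mem_antidiagonal] at hp
  rcases lt_or_ge M p.1 with h | h
  · rw [hf _ h, zero_mul]
  · rw [hg p.2 (by omega), mul_zero]

lemma X_pow (k : ℕ) : DegLE k (X ^ k : PowerSeries R) := fun n hn => by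
  rw [coeff_X_pow, if_neg hn.ne']

lemma trunc (w : PowerSeries R) (k : ℕ) :
    DegLE k (PowerSeries.trunc (k + 1) w : PowerSeries R) := fun n hn => by
  rw [Polynomial.coeff_coe, coeff_trunc, if_neg (by omega)]

lemma eq_zero (hf : DegLE N f) (h : X ^ (N + 1) ∣ f) : f = 0 := by
  ext n
  rcases lt_or_ge N n with hn | hn
  · rw [hf n hn, map_zero]
  · rw [X_pow_dvd_iff.1 h n (by omega), map_zero]

end DegLE

lemma X_pow_dvd_sub_trunc (w : PowerSeries R) (k : ℕ) :
    X ^ k ∣ w - (PowerSeries.trunc k w : PowerSeries R) := by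
  rw [X_pow_dvd_iff]
  intro m hm
  rw [map_sub, Polynomial.coeff_coe, coeff_trunc, if_pos hm, sub_self]

variable {𝕜 : Type*} [CommRing 𝕜] [Algebra 𝕜 R]

/-- The derivation of `R⟦X⟧` that applies a derivation of `R` to every coefficient. -/
noncomputable def coeffDerivation (D : Derivation 𝕜 R R) :
    Derivation 𝕜 (PowerSeries R) (PowerSeries R) :=
  Derivation.mk'
    { toFun := fun f => mk fun n => D (coeff n f)
      map_add' := fun f g => by ext n; simp
      map_smul' := fun c f => by ext n; simp }
    fun f g => by
      ext n
      simp only [LinearMap.coe_mk, AddHom.coe_mk, coeff_mk, smul_eq_mul, map_add, coeff_mul,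
        map_sum, Derivation.leibniz, Finset.sum_add_distrib]
      congr 1
      rw [← Finset.Nat.sum_antidiagonal_swap]
      rfl

@[simp] lemma coeff_coeffDerivation (D : Derivation 𝕜 R R) (f : PowerSeries R) (n : ℕ) :
    coeff n (coeffDerivation D f) = D (coeff n f) :=
  coeff_mk n fun n => D (coeff n f)

lemma coeffDerivation_X_pow (D : Derivation 𝕜 R R) (k : ℕ) :
    coeffDerivation D (X ^ k : PowerSeries R) = 0 := by
  ext n
  rw [coeff_coeffDerivation, coeff_X_pow]
  split_ifs <;> simp

lemma coeffDerivation_X_pow_mul (D : Derivation 𝕜 R R) (k : ℕ) (f : PowerSeries R) :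
    coeffDerivation D (X ^ k * f) = X ^ k * coeffDerivation D f := by
  rw [Derivation.leibniz, coeffDerivation_X_pow, smul_zero, add_zero, smul_eq_mul]

lemma X_pow_dvd_coeffDerivation (D : Derivation 𝕜 R R) {k : ℕ} {f : PowerSeries R}
    (h : X ^ k ∣ f) : X ^ k ∣ coeffDerivation D f := by
  obtain ⟨q, rfl⟩ := h
  exact ⟨_, coeffDerivation_X_pow_mul D k q⟩

lemma DegLE.coeffDerivation {N : ℕ} {f : PowerSeries R} (hf : DegLE N f)
    (D : Derivation 𝕜 R R) : DegLE N (coeffDerivation D f) := fun n hn => by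
  rw [coeff_coeffDerivation, hf n hn, map_zero]

/-! ### The zero-curvature equation -/

/-- The zero-curvature equation.  If two derivations act on `w` by
`λ^{-k} D_k w = a_k w' - a_k' w` with `a_k` the truncation of `w` at order `k` (so that
`λ^k a_k` is the polynomial part of `λ^k w`, where `X = λ⁻¹`), then their actions on the
truncations satisfy `λ^{-k} D_k a_l - λ^{-l} D_l a_k = a_k a_l' - a_l a_k'`.  Both sides have degree
at most `k + l`, and modulo `X ^ (k + l + 2)` their difference is
`-[w - a_k, w - a_l]`, which vanishes to that order. -/
lemma trunc_zero_curvature (Dx Dk Dl : Derivation 𝕜 R R) (w : PowerSeries R) (k l : ℕ)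
    (hk : X ^ k * coeffDerivation Dk w =
      (trunc (k + 1) w : PowerSeries R) * coeffDerivation Dx w
        - w * coeffDerivation Dx (trunc (k + 1) w : PowerSeries R))
    (hl : X ^ l * coeffDerivation Dl w =
      (trunc (l + 1) w : PowerSeries R) * coeffDerivation Dx w
        - w * coeffDerivation Dx (trunc (l + 1) w : PowerSeries R)) :
    X ^ k * coeffDerivation Dk (trunc (l + 1) w : PowerSeries R)
        - X ^ l * coeffDerivation Dl (trunc (k + 1) w : PowerSeries R)
      = (trunc (k + 1) w : PowerSeries R) * coeffDerivation Dx (trunc (l + 1) w : PowerSeries R)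
        - (trunc (l + 1) w : PowerSeries R)
          * coeffDerivation Dx (trunc (k + 1) w : PowerSeries R) := by
  have hak := DegLE.trunc w k
  have hal := DegLE.trunc w l
  have hbk := X_pow_dvd_sub_trunc w (k + 1)
  have hbl := X_pow_dvd_sub_trunc w (l + 1)
  generalize (trunc (k + 1) w : PowerSeries R) = a at *
  generalize (trunc (l + 1) w : PowerSeries R) = b at *
  rw [← sub_eq_zero]
  refine DegLE.eq_zero (N := k + l) ?_ ?_
  · refine ((((DegLE.X_pow k).mul (hal.coeffDerivation Dk)).sub ?_).sub
      ((hak.mul (hal.coeffDerivation Dx)).sub ?_))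
    · exact ((DegLE.X_pow l).mul (hak.coeffDerivation Dl)).mono (by omega)
    · exact (hal.mul (hak.coeffDerivation Dx)).mono (by omega)
  · have e : X ^ k * coeffDerivation Dk b - X ^ l * coeffDerivation Dl a
          - (a * coeffDerivation Dx b - b * coeffDerivation Dx a)
        = X ^ l * coeffDerivation Dl (w - a) - X ^ k * coeffDerivation Dk (w - b)
          - ((w - a) * coeffDerivation Dx (w - b) - (w - b) * coeffDerivation Dx (w - a)) := by
      simp only [map_sub, mul_sub, hk, hl]
      ring
    rw [e]
    refine dvd_sub (dvd_sub ?_ ?_) (dvd_sub ?_ ?_)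
    · rw [show k + l + 1 = l + (k + 1) by omega, pow_add]
      exact mul_dvd_mul_left _ (X_pow_dvd_coeffDerivation Dl hbk)
    · rw [show k + l + 1 = k + (l + 1) by omega, pow_add]
      exact mul_dvd_mul_left _ (X_pow_dvd_coeffDerivation Dk hbl)
    · refine (pow_dvd_pow _ (by omega : k + l + 1 ≤ (k + 1) + (l + 1))).trans ?_
      rw [pow_add]
      exact mul_dvd_mul hbk (X_pow_dvd_coeffDerivation Dx hbl)
    · refine (pow_dvd_pow _ (by omega : k + l + 1 ≤ (l + 1) + (k + 1))).trans ?_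
      rw [pow_add]
      exact mul_dvd_mul hbl (X_pow_dvd_coeffDerivation Dx hbk)

/-- A flow that is prescribed on the first coefficients of a square root `h` of a polynomial of
degree `N` holds for all of `h`: twice the product of `h` with the defect
`X ^ k * D_k h - D_x (a h)` has degree at most `N + k`, because it only involves `h ^ 2`, while the
defect is divisible by `X ^ (N + k + 1)`. -/
lemma flow_of_trunc_flow (h2 : IsUnit (2 : R)) (Dx Dk : Derivation 𝕜 R R) {h w a : PowerSeries R}
    (hw : w * h = 1) {N k : ℕ} (hU : DegLE N (h ^ 2)) (ha : DegLE k a)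
    (hflow : X ^ (N + k + 1) ∣ X ^ k * coeffDerivation Dk h - coeffDerivation Dx (a * h)) :
    X ^ k * coeffDerivation Dk h = coeffDerivation Dx (a * h) := by
  rw [← sub_eq_zero]
  set E := X ^ k * coeffDerivation Dk h - coeffDerivation Dx (a * h) with hE
  have key : 2 * h * E = X ^ k * coeffDerivation Dk (h ^ 2)
      - (2 * coeffDerivation Dx a * h ^ 2 + a * coeffDerivation Dx (h ^ 2)) := by
    rw [hE, Derivation.leibniz, Derivation.leibniz_pow, Derivation.leibniz_pow]
    simp only [smul_eq_mul, nsmul_eq_mul]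
    push_cast
    ring
  have hzero : 2 * h * E = 0 := by
    refine DegLE.eq_zero (N := N + k) ?_ (hflow.mul_left _)
    rw [key]
    refine DegLE.sub ?_ (DegLE.add ?_ ?_)
    · exact ((DegLE.X_pow k).mul (hU.coeffDerivation Dk)).mono (by omega)
    · rw [two_mul]
      exact (((ha.coeffDerivation Dx).add (ha.coeffDerivation Dx)).mul hU).mono (by omega)
    · exact (ha.mul (hU.coeffDerivation Dx)).mono (by omega)
  have h2' : IsUnit (2 : PowerSeries R) := by
    have := h2.map (C (R := R))
    rwa [map_ofNat] at this
  have : 2 * E = 0 := by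
    have := congrArg (w * ·) hzero
    simp only [mul_zero] at this
    rw [← this]
    linear_combination (-(2 * E)) * hw
  exact (h2'.mul_right_eq_zero).1 this

/-- The commutation of two flows `λ^{-k} D_k h = (a_k h)'`: the derivative of `a_l h` along the
`k`-th flow agrees with the derivative of `a_k h` along the `l`-th flow. -/
lemma flows_symmetric (Dx Dk Dl : Derivation 𝕜 R R) {h w : PowerSeries R}
    (hw : w * h = 1) (k l : ℕ)
    (hk : X ^ k * coeffDerivation Dk h =
      coeffDerivation Dx ((trunc (k + 1) w : PowerSeries R) * h))
    (hl : X ^ l * coeffDerivation Dl h =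
      coeffDerivation Dx ((trunc (l + 1) w : PowerSeries R) * h)) :
    X ^ k * coeffDerivation Dk ((trunc (l + 1) w : PowerSeries R) * h)
      = X ^ l * coeffDerivation Dl ((trunc (k + 1) w : PowerSeries R) * h) := by
  have hDw : ∀ D : Derivation 𝕜 R R, coeffDerivation D w = - w ^ 2 * coeffDerivation D h := by
    intro D
    have := congrArg (coeffDerivation D) hw
    rw [Derivation.leibniz, Derivation.map_one_eq_zero, smul_eq_mul, smul_eq_mul] at this
    linear_combination w * this - coeffDerivation D w * hw
  have hflow : ∀ (D : Derivation 𝕜 R R) (m : ℕ), X ^ m * coeffDerivation D h =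
      coeffDerivation Dx ((trunc (m + 1) w : PowerSeries R) * h) →
      X ^ m * coeffDerivation D w = (trunc (m + 1) w : PowerSeries R) * coeffDerivation Dx w
        - w * coeffDerivation Dx (trunc (m + 1) w : PowerSeries R) := by
    intro D m hm
    rw [Derivation.leibniz, smul_eq_mul, smul_eq_mul] at hm
    rw [hDw, hDw]
    linear_combination (-w ^ 2) * hm
      - w * coeffDerivation Dx (trunc (m + 1) w : PowerSeries R) * hw
  have hz := trunc_zero_curvature Dx Dk Dl w k l (hflow Dk k hk) (hflow Dl l hl)
  simp only [Derivation.leibniz, smul_eq_mul] at hk hl ⊢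
  linear_combination h * hz + (trunc (l + 1) w : PowerSeries R) * hk
    - (trunc (k + 1) w : PowerSeries R) * hl

end PowerSeries

/-! ### Square roots of power series and the table of a power series -/

section Table

variable {𝕜 : Type*} [Field 𝕜] {R S : Type*} [CommRing R] [Algebra 𝕜 R]
  [CommRing S] [Algebra 𝕜 S]

variable (𝕜) in
/-- The coefficients `s_n` of the square root `1 + ∑ s_n X^(n+1)` of `1 + ∑ c_n X^(n+1)`. -/
noncomputable def sqrtSeq (c : ℕ → R) : ℕ → R
  | n => (1 / 2 : 𝕜) • (c n - ∑ a : Fin n, sqrtSeq c a * sqrtSeq c (n - 1 - a))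

variable (𝕜) in
lemma sqrtSeq_eq (c : ℕ → R) (n : ℕ) :
    sqrtSeq 𝕜 c n = (1 / 2 : 𝕜) •
      (c n - ∑ a ∈ Finset.range n, sqrtSeq 𝕜 c a * sqrtSeq 𝕜 c (n - 1 - a)) := by
  rw [sqrtSeq, Finset.sum_range fun a => sqrtSeq 𝕜 c a * sqrtSeq 𝕜 c (n - 1 - a)]

lemma Wgc_shift {g : ℕ} {H : ℕ → ℕ → 𝕜} (hH : H ∈ Wgc 𝕜 g) (j l : ℕ) :
    H j (l + 1) = H (j + 1) l + H j 0 * H 0 l := by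
  have := hH.1 j 1 l
  simp only [Finset.range_one, Finset.sum_singleton, Nat.sub_self] at this
  linear_combination this

variable [CharZero 𝕜]

variable (𝕜) in
lemma sqrtSeq_sq (c : ℕ → R) (n : ℕ) :
    2 * sqrtSeq 𝕜 c n
      + ∑ a ∈ Finset.range n, sqrtSeq 𝕜 c a * sqrtSeq 𝕜 c (n - 1 - a) = c n := by
  have h : (2 : R) * sqrtSeq 𝕜 c n = (2 : 𝕜) • sqrtSeq 𝕜 c n := by
    rw [Algebra.smul_def, map_ofNat]
  rw [h, sqrtSeq_eq 𝕜 c n, smul_smul]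
  norm_num

lemma sqrtSeq_unique {c s : ℕ → R} {N : ℕ}
    (h : ∀ n ≤ N, 2 * s n + ∑ a ∈ Finset.range n, s a * s (n - 1 - a) = c n) :
    ∀ n ≤ N, s n = sqrtSeq 𝕜 c n := by
  intro n
  induction n using Nat.strong_induction_on with
  | _ n ih =>
    intro hn
    rw [sqrtSeq_eq, ← h n hn]
    have : ∑ a ∈ Finset.range n, sqrtSeq 𝕜 c a * sqrtSeq 𝕜 c (n - 1 - a)
        = ∑ a ∈ Finset.range n, s a * s (n - 1 - a) := by
      refine Finset.sum_congr rfl fun a ha => ?_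
      have ha := Finset.mem_range.1 ha
      rw [ih a ha (by omega), ih (n - 1 - a) (by omega) (by omega)]
    rw [this, add_sub_cancel_right,
      show (2 : R) * s n = (2 : 𝕜) • s n by rw [Algebra.smul_def, map_ofNat], smul_smul]
    norm_num

lemma map_sqrtSeq (f : R →ₐ[𝕜] S) (c : ℕ → R) (n : ℕ) :
    f (sqrtSeq 𝕜 c n) = sqrtSeq 𝕜 (fun m => f (c m)) n := by
  refine sqrtSeq_unique (s := fun m => f (sqrtSeq 𝕜 c m)) (N := n) (fun m _ => ?_) n le_rfl
  rw [← sqrtSeq_sq 𝕜 c m]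
  simp [map_ofNat f 2]

/-- The power series `1 + ∑ r_n X^(n+1)`. -/
noncomputable def oneSeries (r : ℕ → R) : PowerSeries R :=
  1 + PowerSeries.X * PowerSeries.mk r

lemma constantCoeff_oneSeries (r : ℕ → R) :
    PowerSeries.constantCoeff (oneSeries r) = 1 := by
  simp [oneSeries]

lemma coeff_oneSeries (r : ℕ → R) (n : ℕ) : PowerSeries.coeff (n + 1) (oneSeries r) = r n := by
  simp [oneSeries, PowerSeries.coeff_succ_X_mul, PowerSeries.coeff_one]

variable (𝕜) in
lemma oneSeries_sqrtSeq_sq (c : ℕ → R) : oneSeries (sqrtSeq 𝕜 c) ^ 2 = oneSeries c := by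
  have e : oneSeries (sqrtSeq 𝕜 c) ^ 2 = 1 + PowerSeries.X *
      (2 * PowerSeries.mk (sqrtSeq 𝕜 c)
        + PowerSeries.X * (PowerSeries.mk (sqrtSeq 𝕜 c) * PowerSeries.mk (sqrtSeq 𝕜 c))) := by
    rw [oneSeries]; ring
  rw [e, oneSeries]
  congr 2
  ext n
  rw [PowerSeries.coeff_mk, ← sqrtSeq_sq 𝕜 c n, map_add]
  congr 1
  · rw [← map_ofNat (PowerSeries.C (R := R)), PowerSeries.coeff_C_mul, PowerSeries.coeff_mk]
  · cases n with
    | zero => simp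
    | succ n =>
      rw [PowerSeries.coeff_succ_X_mul, PowerSeries.coeff_mul,
        Finset.Nat.sum_antidiagonal_eq_sum_range_succ_mk]
      simp

/-- The inverse of the power series `1 + ∑ r_n X^(n+1)`. -/
noncomputable def invSeries (r : ℕ → R) : PowerSeries R :=
  PowerSeries.invOfUnit (oneSeries r) 1

lemma invSeries_mul (r : ℕ → R) : invSeries r * oneSeries r = 1 :=
  PowerSeries.invOfUnit_mul _ _ (by rw [constantCoeff_oneSeries, Units.val_one])

/-- The table of coefficients with base row `r` in which row `j + 1` is determined by
`h_{j+1} = λ h_j - (H j 0) h_0`. -/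
def tableOf (r : ℕ → R) : ℕ → ℕ → R
  | 0 => r
  | j + 1 => fun l => tableOf r j (l + 1) - tableOf r j 0 * r l

lemma map_tableOf (f : R →+* S) (r : ℕ → R) (j l : ℕ) :
    f (tableOf r j l) = tableOf (fun n => f (r n)) j l := by
  induction j generalizing l with
  | zero => rfl
  | succ j ih => simp [tableOf, ih]

lemma mk_tableOf (r : ℕ → R) (k : ℕ) : PowerSeries.mk (tableOf r k)
    = PowerSeries.C (tableOf r k 0) * oneSeries r
      + PowerSeries.X * PowerSeries.mk (tableOf r (k + 1)) := by
  ext n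
  cases n with
  | zero => simp [constantCoeff_oneSeries]
  | succ n =>
    rw [map_add, PowerSeries.coeff_C_mul, coeff_oneSeries, PowerSeries.coeff_succ_X_mul]
    simp [tableOf]

/-- Row `k` of the table is the negative part of `λ^k a_k h`, where `a_k` is the truncation of
`1 / h` at order `k`. -/
lemma trunc_mul_oneSeries (r : ℕ → R) (k : ℕ) :
    (PowerSeries.trunc (k + 1) (invSeries r) : PowerSeries R) * oneSeries r
      = 1 + PowerSeries.X ^ (k + 1) * PowerSeries.mk (tableOf r k) := by
  induction k with
  | zero =>
    have : PowerSeries.constantCoeff (invSeries r) = 1 := by simp [invSeries]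
    simp [oneSeries, tableOf, PowerSeries.trunc_one_left, this]
  | succ k ih =>
    -- since `w h = 1`, the tail of `w` beyond `X^k` times `h` cancels the negative part of `a_k h`
    have hw : PowerSeries.coeff (k + 1) (invSeries r) = - tableOf r k 0 := by
      obtain ⟨q, hq⟩ := PowerSeries.X_pow_dvd_sub_trunc (invSeries r) (k + 1)
      have h1 : PowerSeries.X ^ (k + 1) * (q * oneSeries r)
          = PowerSeries.X ^ (k + 1) * (- PowerSeries.mk (tableOf r k)) := by
        linear_combination invSeries_mul r - ih - oneSeries r * hq
      have h2 := congrArg (PowerSeries.coeff (k + 1)) h1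
      have h3 := congrArg (PowerSeries.coeff (k + 1)) hq
      rw [PowerSeries.coeff_X_pow_mul', PowerSeries.coeff_X_pow_mul'] at h2
      rw [PowerSeries.coeff_X_pow_mul', map_sub, Polynomial.coeff_coe,
        PowerSeries.coeff_trunc] at h3
      simp [constantCoeff_oneSeries] at h2 h3
      rw [h3, h2]
    rw [PowerSeries.trunc_succ, Polynomial.coe_add, add_mul, ih, hw, mk_tableOf,
      Polynomial.coe_monomial, PowerSeries.monomial_eq_C_mul_X_pow, map_neg]
    ring

/-! ### The set `W_{gc}` -/

/-- The linear relations of `W_{gc}`: the case `k = 1` is the recursion that defines the table. -/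
lemma tableOf_shift (r : ℕ → R) (j k l : ℕ) :
    tableOf r j (l + k) = tableOf r (j + k) l
      + ∑ i ∈ Finset.range k, tableOf r j i * tableOf r (k - 1 - i) l := by
  induction k generalizing l with
  | zero => simp
  | succ k ih =>
    have step : ∀ m n, tableOf r m (n + 1) = tableOf r (m + 1) n + tableOf r m 0 * r n := by
      intro m n; simp [tableOf]
    have h0 := ih 0
    rw [zero_add] at h0
    rw [show l + (k + 1) = l + 1 + k by ring, ih (l + 1), step, Finset.sum_range_succ, h0,
      Nat.add_sub_cancel, Nat.sub_self]
    have e : ∑ i ∈ Finset.range k, tableOf r j i * tableOf r (k - 1 - i) (l + 1)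
        = ∑ i ∈ Finset.range k, tableOf r j i * tableOf r (k - i) l
          + (∑ i ∈ Finset.range k, tableOf r j i * tableOf r (k - 1 - i) 0) * r l := by
      rw [Finset.sum_mul, ← Finset.sum_add_distrib]
      refine Finset.sum_congr rfl fun i hi => ?_
      have hi := Finset.mem_range.1 hi
      rw [step, show k - 1 - i + 1 = k - i by omega]
      ring
    rw [e, ← add_assoc j k 1]
    simp only [tableOf]
    ring

/-- The products of two rows satisfy the quadratic relations of `W_{gc}` because
`(a_j h) (a_k h) = a_j a_k h²` is a polynomial of degree at most `j + k + N + 1` in `λ⁻¹`. -/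
lemma tableOf_mul {r : ℕ → R} {N : ℕ} (hU : PowerSeries.DegLE (N + 1) (oneSeries r ^ 2))
    (j k m : ℕ) :
    tableOf r j (N + k + (m + 1)) + tableOf r k (N + j + (m + 1))
      + ∑ ab ∈ Finset.HasAntidiagonal.antidiagonal (N + m),
          tableOf r j ab.1 * tableOf r k ab.2 = 0 := by
  have hd := ((PowerSeries.DegLE.trunc (invSeries r) j).mul
    (PowerSeries.DegLE.trunc (invSeries r) k)).mul hU
  have e : (PowerSeries.trunc (j + 1) (invSeries r) : PowerSeries R)
        * (PowerSeries.trunc (k + 1) (invSeries r) : PowerSeries R) * oneSeries r ^ 2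
      = 1 + (PowerSeries.X ^ (j + 1) * PowerSeries.mk (tableOf r j)
        + PowerSeries.X ^ (k + 1) * PowerSeries.mk (tableOf r k)
        + PowerSeries.X ^ (j + k + 2)
          * (PowerSeries.mk (tableOf r j) * PowerSeries.mk (tableOf r k))) := by
    have hj := trunc_mul_oneSeries r j
    have hk := trunc_mul_oneSeries r k
    linear_combination (PowerSeries.trunc (k + 1) (invSeries r) : PowerSeries R) * oneSeries r * hj
      + (1 + PowerSeries.X ^ (j + 1) * PowerSeries.mk (tableOf r j)) * hk
  have := hd (j + k + 2 + (N + m)) (by omega)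
  rw [e, map_add, map_add, map_add, PowerSeries.coeff_X_pow_mul', PowerSeries.coeff_X_pow_mul',
    PowerSeries.coeff_X_pow_mul', if_pos (by omega), if_pos (by omega), if_pos (by omega),
    PowerSeries.coeff_mk, PowerSeries.coeff_mk, PowerSeries.coeff_mul, PowerSeries.coeff_one,
    if_neg (by omega), zero_add,
    show j + k + 2 + (N + m) - (j + 1) = N + k + (m + 1) by omega,
    show j + k + 2 + (N + m) - (k + 1) = N + j + (m + 1) by omega,
    show j + k + 2 + (N + m) - (j + k + 2) = N + m by omega] at this
  simpa only [PowerSeries.coeff_mk] using this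

/-- The coefficients `c_n` in `1 + ∑ c_n X^(n+1) = λ^{-(2g+1)} (λ^(2g+1) + ∑ u_s λ^s)`, where
`X = λ⁻¹`; the branch condition keeps `2g - n` from being truncated. -/
def curveSeq (g : ℕ) (u : Fin (2 * g + 1) → R) (n : ℕ) : R :=
  if n < 2 * g + 1 then u (Fin.ofNat (2 * g + 1) (2 * g - n)) else 0

lemma curveSeq_val (g : ℕ) (u : Fin (2 * g + 1) → R) (i : Fin (2 * g + 1)) :
    curveSeq g u i = u (Fin.rev i) := by
  rw [curveSeq, if_pos i.2]
  congr 1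
  ext
  have := i.2
  simp only [Fin.val_ofNat, Fin.val_rev]
  rw [Nat.mod_eq_of_lt] <;> omega

lemma curveSeq_of_le (g : ℕ) (u : Fin (2 * g + 1) → R) {n : ℕ} (hn : 2 * g + 1 ≤ n) :
    curveSeq g u n = 0 := by
  rw [curveSeq, if_neg (by omega)]

lemma degLE_oneSeries_curveSeq (g : ℕ) (u : Fin (2 * g + 1) → R) :
    PowerSeries.DegLE (2 * g + 1) (oneSeries (curveSeq g u)) := by
  intro n hn
  obtain ⟨m, rfl⟩ : ∃ m, n = m + 1 := ⟨n - 1, by omega⟩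
  rw [coeff_oneSeries, curveSeq_of_le g u (by omega)]

/-- The coefficients of the curve as functions of `v`, over an arbitrary ring. -/
def curveMap (g : ℕ) (v : Fin (2 * g + 1) → R) : Fin (2 * g + 1) → R :=
  fun s => 2 * v (Fin.rev s)
    + ∑ a : Fin (2 * g + 1), ∑ b : Fin (2 * g + 1),
        if (a : ℕ) + b + 1 + s = 2 * g then v a * v b else 0

lemma curveMap_eq (g : ℕ) {v : Fin (2 * g + 1) → R} {s : ℕ → R}
    (hs : ∀ i : Fin (2 * g + 1), s i = v i)
    (i : Fin (2 * g + 1)) :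
    curveMap g v (Fin.rev i)
      = 2 * s i + ∑ a ∈ Finset.range i, s a * s (i - 1 - a) := by
  have hi := i.2
  rw [curveMap, Fin.rev_rev, hs]
  congr 1
  have e : ∀ a : Fin (2 * g + 1), (∑ b : Fin (2 * g + 1),
      if (a : ℕ) + b + 1 + (Fin.rev i : ℕ) = 2 * g then v a * v b else 0)
      = if (a : ℕ) < i then s a * s (i - 1 - a) else 0 := by
    intro a
    have := a.2
    split_ifs with h
    · rw [Finset.sum_eq_single (⟨i - 1 - a, by omega⟩ : Fin (2 * g + 1)), if_pos, ← hs, ← hs]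
      · rw [Fin.val_rev]; simp only; omega
      · intro b _ hb
        rw [if_neg]
        intro h'
        apply hb
        ext
        rw [Fin.val_rev] at h'
        simp only
        omega
      · simp
    · refine Finset.sum_eq_zero fun b _ => if_neg ?_
      rw [Fin.val_rev]
      omega
  rw [Finset.sum_congr rfl fun a _ => e a,
    Fin.sum_univ_eq_sum_range (fun a => if a < (i : ℕ) then s a * s (i - 1 - a) else 0),
    ← Finset.sum_filter]
  congr 1
  ext a
  simp only [Finset.mem_filter, Finset.mem_range]
  omega

lemma map_curveMap (g : ℕ) (f : R →+* S) (v : Fin (2 * g + 1) → R) (s : Fin (2 * g + 1)) :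
    f (curveMap g v s) = curveMap g (fun i => f (v i)) s := by
  simp [curveMap, apply_ite f, map_ofNat f 2]

lemma map_curveSeq (g : ℕ) (f : R →+* S) (u : Fin (2 * g + 1) → R) (n : ℕ) :
    f (curveSeq g u n) = curveSeq g (fun i => f (u i)) n := by
  simp [curveSeq, apply_ite f]

variable (𝕜) in
/-- The base row `H 0 s` of the point of `W_{gc}` with coordinates `v`. -/
noncomputable def rootSeq (g : ℕ) (v : Fin (2 * g + 1) → R) : ℕ → R :=
  sqrtSeq 𝕜 (curveSeq g (curveMap g v))

variable (𝕜) in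
lemma rootSeq_val (g : ℕ) (v : Fin (2 * g + 1) → R) (i : Fin (2 * g + 1)) :
    rootSeq 𝕜 g v i = v i := by
  have hs : ∀ j : Fin (2 * g + 1), (fun n => v (Fin.ofNat (2 * g + 1) n)) (j : ℕ) = v j := by
    intro j; simp
  rw [rootSeq, ← sqrtSeq_unique (s := fun n => v (Fin.ofNat (2 * g + 1) n)) (N := 2 * g)
    (c := curveSeq g (curveMap g v)) _ i (by omega)]
  · exact hs i
  intro n hn
  have := curveSeq_val g (curveMap g v) ⟨n, by omega⟩
  rw [curveMap_eq g (s := fun n => v (Fin.ofNat (2 * g + 1) n)) hs] at this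
  exact this.symm

variable (𝕜) in
lemma curveMap_sqrtSeq (g : ℕ) (u : Fin (2 * g + 1) → R) :
    curveMap g (fun i => sqrtSeq 𝕜 (curveSeq g u) i) = u := by
  ext i
  have := curveMap_eq g (v := fun i => sqrtSeq 𝕜 (curveSeq g u) i)
    (s := sqrtSeq 𝕜 (curveSeq g u)) (fun _ => rfl) (Fin.rev i)
  rw [Fin.rev_rev] at this
  rw [this, sqrtSeq_sq, curveSeq_val, Fin.rev_rev]

lemma map_rootSeq (g : ℕ) (f : R →ₐ[𝕜] S) (v : Fin (2 * g + 1) → R) (n : ℕ) :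
    f (rootSeq 𝕜 g v n) = rootSeq 𝕜 g (fun i => f (v i)) n := by
  rw [rootSeq, map_sqrtSeq, rootSeq]
  congr 1
  funext m
  have h1 := map_curveSeq g (f : R →+* S) (curveMap g v) m
  simp only [map_curveMap] at h1
  exact h1

variable (𝕜) in
lemma oneSeries_rootSeq_sq (g : ℕ) (v : Fin (2 * g + 1) → R) :
    oneSeries (rootSeq 𝕜 g v) ^ 2 = oneSeries (curveSeq g (curveMap g v)) :=
  oneSeries_sqrtSeq_sq 𝕜 _

variable (𝕜) in
lemma degLE_oneSeries_rootSeq_sq (g : ℕ) (v : Fin (2 * g + 1) → R) :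
    PowerSeries.DegLE (2 * g + 1) (oneSeries (rootSeq 𝕜 g v) ^ 2) := by
  rw [oneSeries_rootSeq_sq]
  exact degLE_oneSeries_curveSeq g _

lemma tableOf_rootSeq_mem (g : ℕ) (v : Fin (2 * g + 1) → 𝕜) :
    tableOf (rootSeq 𝕜 g v) ∈ Wgc 𝕜 g := by
  refine ⟨fun j k l => ?_, fun j k m => ?_⟩
  · rw [tableOf_shift]
    ring
  · exact tableOf_mul (degLE_oneSeries_rootSeq_sq 𝕜 g v) j k m

lemma baseCoords_tableOf (g : ℕ) (v : Fin (2 * g + 1) → 𝕜) :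
    baseCoords g (tableOf (rootSeq 𝕜 g v)) = v := by
  funext i
  exact rootSeq_val 𝕜 g v i

/-- A point of `W_{gc}` is the table of the square root determined by its first `2g+1`
coordinates. -/
lemma eq_tableOf_of_mem_Wgc {g : ℕ} {H : ℕ → ℕ → 𝕜} (hH : H ∈ Wgc 𝕜 g) :
    H = tableOf (rootSeq 𝕜 g (baseCoords g H)) := by
  have h0 : ∀ n, H 0 n = rootSeq 𝕜 g (baseCoords g H) n := by
    intro n
    refine sqrtSeq_unique (N := n) (fun m _ => ?_) n le_rfl
    rcases lt_or_ge m (2 * g + 1) with hm | hm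
    · have := curveSeq_val g (curveMap g (baseCoords g H)) ⟨m, hm⟩
      rw [curveMap_eq g (v := baseCoords g H) (s := H 0) (fun _ => rfl)] at this
      exact this.symm
    · rw [curveSeq_of_le g _ hm]
      have := hH.2 0 0 (m - (2 * g + 1))
      rw [Finset.Nat.sum_antidiagonal_eq_sum_range_succ_mk] at this
      rw [← this, show 2 * g + 0 + (m - (2 * g + 1) + 1) = m by omega,
        show 2 * g + (m - (2 * g + 1)) = m - 1 by omega, Nat.succ_eq_add_one,
        show m - 1 + 1 = m by omega]
      ring
  funext j
  induction j with
  | zero => funext n; exact h0 n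
  | succ j ih =>
    funext l
    have := Wgc_shift hH j l
    simp only [tableOf]
    rw [← ih, ← h0, this]
    ring

end Table

/-! ### Laurent series of the points of `W_{gc}` -/

section Laurent

variable {𝕜 : Type*} [Field 𝕜]

variable (𝕜) in
/-- The substitution `X = λ⁻¹ = t²`, from power series to Laurent series in `t`. -/
noncomputable def sqSubst : PowerSeries 𝕜 →+* LaurentSeries 𝕜 :=
  (HahnSeries.embDomainRingHom ((2 : ℕ) • Nat.castAddMonoidHom ℤ)
    (fun a b h => by simpa using h) (fun a b => by simp)).comp
    (RingEquiv.toRingHom HahnSeries.toPowerSeries.symm)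

lemma coeff_sqSubst_two_mul (f : PowerSeries 𝕜) (n : ℕ) :
    (sqSubst 𝕜 f).coeff (2 * (n : ℤ)) = PowerSeries.coeff n f := by
  have e : (2 * (n : ℤ)) = ((2 : ℕ) • Nat.castAddMonoidHom ℤ) n := by simp
  rw [e]
  exact HahnSeries.embDomain_coeff

lemma coeff_sqSubst_of_ne (f : PowerSeries 𝕜) {m : ℤ} (hm : ∀ n : ℕ, m ≠ 2 * (n : ℤ)) :
    (sqSubst 𝕜 f).coeff m = 0 := by
  refine HahnSeries.embDomain_of_notMem_range ?_
  rintro ⟨n, hn⟩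
  have : ((2 : ℕ) • Nat.castAddMonoidHom ℤ) n = m := hn
  exact hm n (by rw [← this]; simp)

lemma sqSubst_eq_ofPowerSeries (a : ℕ → 𝕜) :
    HahnSeries.ofPowerSeries ℤ 𝕜 (PowerSeries.mk fun n => if Even n then a (n / 2) else 0)
      = sqSubst 𝕜 (PowerSeries.mk a) := by
  ext m
  rcases lt_or_ge m 0 with hm | hm
  · rw [coeff_sqSubst_of_ne _ (by omega)]
    refine HahnSeries.embDomain_of_notMem_range ?_
    rintro ⟨n, hn⟩
    have : (n : ℤ) = m := hn
    omega
  · lift m to ℕ using hm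
    rw [HahnSeries.ofPowerSeries_apply_coeff, PowerSeries.coeff_mk]
    split_ifs with h
    · obtain ⟨k, rfl⟩ := h
      have := coeff_sqSubst_two_mul (PowerSeries.mk a) k
      rw [PowerSeries.coeff_mk] at this
      rw [show ((k + k : ℕ) : ℤ) = 2 * (k : ℤ) by push_cast; ring, this]
      congr 1
      omega
    · rw [coeff_sqSubst_of_ne]
      intro n hn
      exact h ⟨n, by omega⟩

/-- The algebra structure found on Laurent series is the one induced from power series, whereas the
scalar multiplication of `pointSpace` is the coefficientwise one; both are multiplication by
constant series. -/
lemma algebraMap_laurentSeries (a : 𝕜) :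
    algebraMap 𝕜 (LaurentSeries 𝕜) a = HahnSeries.C a := by
  rw [HahnSeries.algebraMap_apply', PowerSeries.algebraMap_apply, HahnSeries.ofPowerSeries_C]
  rfl

lemma sqSubst_C (a : 𝕜) : sqSubst 𝕜 (PowerSeries.C a) = algebraMap 𝕜 (LaurentSeries 𝕜) a := by
  rw [algebraMap_laurentSeries]
  ext m
  by_cases h : ∃ n : ℕ, m = 2 * (n : ℤ)
  · obtain ⟨n, rfl⟩ := h
    rw [coeff_sqSubst_two_mul, PowerSeries.coeff_C]
    rcases Nat.eq_zero_or_pos n with rfl | hn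
    · simp
    · rw [if_neg hn.ne']
      simp [HahnSeries.coeff_single_of_ne, hn.ne']
  · push Not at h
    rw [coeff_sqSubst_of_ne _ h]
    have : m ≠ 0 := by simpa using h 0
    simp [this]

lemma sqSubst_X_pow (k : ℕ) :
    sqSubst 𝕜 (PowerSeries.X ^ k) = HahnSeries.single (2 * (k : ℤ)) 1 := by
  ext m
  by_cases h : ∃ n : ℕ, m = 2 * (n : ℤ)
  · obtain ⟨n, rfl⟩ := h
    rw [coeff_sqSubst_two_mul, PowerSeries.coeff_X_pow, HahnSeries.coeff_single]
    simp
  · push Not at h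
    rw [coeff_sqSubst_of_ne _ h, HahnSeries.coeff_single_of_ne (h k)]

variable (𝕜) in
lemma lamSeries_pow (m : ℕ) : lamSeries 𝕜 ^ m = HahnSeries.single (-2 * (m : ℤ)) 1 := by
  rw [lamSeries, HahnSeries.single_pow, one_pow]
  congr 1
  simp [mul_comm]

/-- The basis series as `z^(2(g+j)+1)` times a power series in `λ⁻¹`. -/
lemma pSeries_eq (g : ℕ) (H : ℕ → ℕ → 𝕜) (j : ℕ) :
    pSeries g H j = HahnSeries.single (-(2 * ((g : ℤ) + j) + 1)) 1
      * sqSubst 𝕜 (1 + PowerSeries.X ^ (j + 1) * PowerSeries.mk (H j)) := by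
  rw [pSeries, sqSubst_eq_ofPowerSeries, (sqSubst 𝕜).map_add, (sqSubst 𝕜).map_one,
    (sqSubst 𝕜).map_mul, sqSubst_X_pow, mul_add (HahnSeries.single _ _), mul_one, ← mul_assoc,
    HahnSeries.single_mul_single, mul_one]
  congr 4
  push_cast
  ring

lemma pSeries_zero_eq (g : ℕ) (H : ℕ → ℕ → 𝕜) :
    pSeries g H 0 = HahnSeries.single (-(2 * (g : ℤ) + 1)) 1 * sqSubst 𝕜 (oneSeries (H 0)) := by
  rw [pSeries_eq, oneSeries, zero_add, pow_one, Nat.cast_zero, add_zero]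

lemma pSeries_succ {g : ℕ} {H : ℕ → ℕ → 𝕜} (hH : H ∈ Wgc 𝕜 g) (j : ℕ) :
    pSeries g H (j + 1)
      = lamSeries 𝕜 * pSeries g H j - algebraMap 𝕜 _ (H j 0) * pSeries g H 0 := by
  have hT : PowerSeries.mk (H j) = PowerSeries.C (H j 0) * oneSeries (H 0)
      + PowerSeries.X * PowerSeries.mk (H (j + 1)) := by
    ext n
    cases n with
    | zero => simp [constantCoeff_oneSeries]
    | succ n =>
      rw [map_add, PowerSeries.coeff_C_mul, coeff_oneSeries, PowerSeries.coeff_succ_X_mul]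
      simp only [PowerSeries.coeff_mk]
      rw [Wgc_shift hH]
      ring
  have e : 1 + PowerSeries.X ^ (j + 1 + 1) * PowerSeries.mk (H (j + 1))
      = (1 + PowerSeries.X ^ (j + 1) * PowerSeries.mk (H j))
        - PowerSeries.C (H j 0) * (PowerSeries.X ^ (j + 1) * oneSeries (H 0)) := by
    rw [hT]; ring
  have e1 : (HahnSeries.single (-(2 * ((g : ℤ) + (j + 1 : ℕ)) + 1)) 1 : LaurentSeries 𝕜)
      = lamSeries 𝕜 * HahnSeries.single (-(2 * ((g : ℤ) + j) + 1)) 1 := by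
    rw [lamSeries, HahnSeries.single_mul_single, mul_one]
    congr 1
    push_cast
    ring_nf
  have e2 : (HahnSeries.single (-(2 * ((g : ℤ) + (j + 1 : ℕ)) + 1)) 1 : LaurentSeries 𝕜)
      * HahnSeries.single (2 * ((j + 1 : ℕ) : ℤ)) 1
      = HahnSeries.single (-(2 * (g : ℤ) + 1)) 1 := by
    rw [HahnSeries.single_mul_single, mul_one]
    congr 1
    push_cast
    ring_nf
  rw [pSeries_eq g H (j + 1), e, map_sub, mul_sub, map_mul, sqSubst_C, map_mul, sqSubst_X_pow,
    pSeries_zero_eq, pSeries_eq g H j, ← e2, e1]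
  ring

lemma exists_monic_mul_pSeries {g : ℕ} {H : ℕ → ℕ → 𝕜} (hH : H ∈ Wgc 𝕜 g) (j : ℕ) :
    ∃ α : Polynomial 𝕜, α.Monic ∧ α.natDegree = j ∧
      pSeries g H j = Polynomial.aeval (lamSeries 𝕜) α * pSeries g H 0 := by
  induction j with
  | zero => exact ⟨1, Polynomial.monic_one, Polynomial.natDegree_one, by simp⟩
  | succ j ih =>
    obtain ⟨α, hm, hd, hα⟩ := ih
    have hXm : (Polynomial.X * α).Monic := Polynomial.monic_X.mul hm
    have hXd : (Polynomial.X * α).natDegree = j + 1 := by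
      rw [Polynomial.natDegree_X_mul hm.ne_zero, hd]
    have hlt : (Polynomial.C (H j 0)).degree < (Polynomial.X * α).degree := by
      refine lt_of_le_of_lt Polynomial.degree_C_le ?_
      rw [Polynomial.degree_eq_natDegree hXm.ne_zero, hXd]
      exact_mod_cast Nat.succ_pos j
    refine ⟨Polynomial.X * α - Polynomial.C (H j 0), hXm.sub_of_left hlt, ?_, ?_⟩
    · rw [Polynomial.natDegree_eq_of_degree_eq (Polynomial.degree_sub_eq_left_of_degree_lt hlt),
        hXd]
    · rw [pSeries_succ hH, hα, map_sub, map_mul, Polynomial.aeval_X, Polynomial.aeval_C]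
      ring

lemma oneSeries_curveSeq (g : ℕ) (u : Fin (2 * g + 1) → 𝕜) :
    oneSeries (curveSeq g u)
      = 1 + ∑ k : Fin (2 * g + 1), PowerSeries.C (u k) * PowerSeries.X ^ (2 * g + 1 - (k : ℕ)) := by
  rw [oneSeries]
  congr 1
  rw [← Equiv.sum_comp Fin.revPerm]
  ext n
  rw [map_sum]
  cases n with
  | zero =>
    rw [PowerSeries.coeff_zero_X_mul]
    refine (Finset.sum_eq_zero fun i _ => ?_).symm
    rw [PowerSeries.coeff_C_mul_X_pow, if_neg]
    have := (Fin.revPerm i).2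
    omega
  | succ n =>
    rw [PowerSeries.coeff_succ_X_mul, PowerSeries.coeff_mk]
    simp only [PowerSeries.coeff_C_mul_X_pow, Fin.revPerm_apply]
    rcases lt_or_ge n (2 * g + 1) with h | h
    · rw [Finset.sum_eq_single (⟨n, h⟩ : Fin (2 * g + 1)), if_pos]
      · exact curveSeq_val g u ⟨n, h⟩
      · rw [Fin.val_rev]; simp only; omega
      · intro i _ hi
        rw [if_neg]
        intro h'
        apply hi
        ext
        rw [Fin.val_rev] at h'
        simp only
        omega
      · simp
    · rw [curveSeq_of_le g u h]
      refine (Finset.sum_eq_zero fun i _ => if_neg ?_).symm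
      rw [Fin.val_rev]
      omega

lemma pSeries_sq [CharZero 𝕜] {g : ℕ} {H : ℕ → ℕ → 𝕜} (hH : H ∈ Wgc 𝕜 g) :
    pSeries g H 0 ^ 2 =
      Polynomial.aeval (lamSeries 𝕜) (curvePoly g (curveCoeff g (baseCoords g H))) := by
  have h0 : H 0 = rootSeq 𝕜 g (baseCoords g H) := congrFun (eq_tableOf_of_mem_Wgc hH) 0
  rw [pSeries_zero_eq, mul_pow, ← (sqSubst 𝕜).map_pow, h0, oneSeries_rootSeq_sq,
    oneSeries_curveSeq, curvePoly, (sqSubst 𝕜).map_add, map_add, (sqSubst 𝕜).map_one, map_sum,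
    map_sum, mul_add, mul_one, Finset.mul_sum, map_pow, Polynomial.aeval_X, lamSeries_pow,
    HahnSeries.single_pow, one_pow]
  have e : (2 • (-(2 * (g : ℤ) + 1))) = -2 * ((2 * g + 1 : ℕ) : ℤ) := by
    push_cast; ring
  rw [e]
  congr 1
  refine Finset.sum_congr rfl fun k _ => ?_
  have hk := k.2
  rw [(sqSubst 𝕜).map_mul, map_mul, sqSubst_C, sqSubst_X_pow, Polynomial.aeval_C, map_pow,
    Polynomial.aeval_X, lamSeries_pow, mul_left_comm, HahnSeries.single_mul_single, mul_one]
  congr 3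
  push_cast [show (k : ℕ) ≤ 2 * g + 1 by omega]
  ring

lemma algebraMap_mul_mem_pointSpace {g : ℕ} {H : ℕ → ℕ → 𝕜} (c : 𝕜) {x : LaurentSeries 𝕜}
    (hx : x ∈ pointSpace g H) : algebraMap 𝕜 _ c * x ∈ pointSpace g H := by
  rw [algebraMap_laurentSeries, HahnSeries.C_mul_eq_smul]
  exact Submodule.smul_mem _ _ hx

lemma lam_mul_mem_pointSpace {g : ℕ} {H : ℕ → ℕ → 𝕜} (hH : H ∈ Wgc 𝕜 g) {x : LaurentSeries 𝕜}
    (hx : x ∈ pointSpace g H) : lamSeries 𝕜 * x ∈ pointSpace g H := by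
  have hp : ∀ j, pSeries g H j ∈ pointSpace g H := fun j =>
    Submodule.subset_span (Or.inr ⟨j, rfl⟩)
  refine Submodule.span_induction (p := fun x _ => lamSeries 𝕜 * x ∈ pointSpace g H) ?_ ?_ ?_ ?_ hx
  · rintro _ (⟨m, rfl⟩ | ⟨j, rfl⟩)
    · exact Submodule.subset_span (Or.inl ⟨m + 1, pow_succ' _ _⟩)
    · have : lamSeries 𝕜 * pSeries g H j = pSeries g H (j + 1)
          + algebraMap 𝕜 _ (H j 0) * pSeries g H 0 := by
        rw [pSeries_succ hH]; ring
      rw [this]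
      exact add_mem (hp _) (algebraMap_mul_mem_pointSpace _ (hp 0))
  · rw [mul_zero]; exact zero_mem _
  · intro x y _ _ hx hy; rw [mul_add]; exact add_mem hx hy
  · intro c x _ hx
    rw [← HahnSeries.C_mul_eq_smul, mul_left_comm, HahnSeries.C_mul_eq_smul]
    exact Submodule.smul_mem _ _ hx

lemma aeval_lam_mul_mem_pointSpace {g : ℕ} {H : ℕ → ℕ → 𝕜} (hH : H ∈ Wgc 𝕜 g)
    {x : LaurentSeries 𝕜} (hx : x ∈ pointSpace g H) (A : Polynomial 𝕜) :
    Polynomial.aeval (lamSeries 𝕜) A * x ∈ pointSpace g H := by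
  induction A using Polynomial.induction_on' with
  | add p q hp hq => rw [map_add, add_mul]; exact add_mem hp hq
  | monomial n a =>
    rw [Polynomial.aeval_monomial, mul_assoc]
    refine algebraMap_mul_mem_pointSpace a ?_
    induction n with
    | zero => simpa using hx
    | succ n ih => rw [pow_succ', mul_assoc]; exact lam_mul_mem_pointSpace hH ih

/-- The point of the Grassmannian is a ring: it is stable under multiplication by `λ` and by
`p_{2g+1}`, whose square is a polynomial in `λ`. -/
lemma adjoin_eq_pointSpace [CharZero 𝕜] {g : ℕ} {H : ℕ → ℕ → 𝕜} (hH : H ∈ Wgc 𝕜 g) :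
    (Algebra.adjoin 𝕜 {lamSeries 𝕜, pSeries g H 0} : Set (LaurentSeries 𝕜))
      = pointSpace g H := by
  have hlam : lamSeries 𝕜 ∈ Algebra.adjoin 𝕜 {lamSeries 𝕜, pSeries g H 0} :=
    Algebra.subset_adjoin (by simp)
  have hp0 : pSeries g H 0 ∈ Algebra.adjoin 𝕜 {lamSeries 𝕜, pSeries g H 0} :=
    Algebra.subset_adjoin (by simp)
  have hone : (1 : LaurentSeries 𝕜) ∈ pointSpace g H :=
    Submodule.subset_span (Or.inl ⟨0, pow_zero _⟩)
  have hp : ∀ j, pSeries g H j ∈ pointSpace g H := fun j =>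
    Submodule.subset_span (Or.inr ⟨j, rfl⟩)
  refine Set.Subset.antisymm (fun x hx => ?_) ?_
  · have key : ∀ y ∈ pointSpace g H, x * y ∈ pointSpace g H := by
      refine Algebra.adjoin_induction (p := fun x _ => ∀ y ∈ pointSpace g H, x * y ∈ pointSpace g H)
        ?_ ?_ ?_ ?_ hx
      · rintro x (rfl | rfl) y hy
        · exact lam_mul_mem_pointSpace hH hy
        · refine Submodule.span_induction
            (p := fun y _ => pSeries g H 0 * y ∈ pointSpace g H) ?_ ?_ ?_ ?_ hy
          · rintro _ (⟨m, rfl⟩ | ⟨j, rfl⟩)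
            · have := aeval_lam_mul_mem_pointSpace hH (hp 0) (Polynomial.X ^ m)
              rwa [map_pow, Polynomial.aeval_X, mul_comm] at this
            · obtain ⟨α, -, -, hα⟩ := exists_monic_mul_pSeries hH j
              have := aeval_lam_mul_mem_pointSpace hH hone
                (α * curvePoly g (curveCoeff g (baseCoords g H)))
              rw [mul_one, map_mul, ← pSeries_sq hH] at this
              simp only [hα]
              convert this using 1
              ring
          · rw [mul_zero]; exact zero_mem _
          · intro x y _ _ hx hy; rw [mul_add]; exact add_mem hx hy
          · intro c x _ hx
            rw [← HahnSeries.C_mul_eq_smul, mul_left_comm, HahnSeries.C_mul_eq_smul]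
            exact Submodule.smul_mem _ _ hx
      · intro r y hy
        exact algebraMap_mul_mem_pointSpace r hy
      · intro a b _ _ ha hb y hy
        rw [add_mul]
        exact add_mem (ha y hy) (hb y hy)
      · intro a b _ _ ha hb y hy
        rw [mul_assoc]
        exact ha _ (hb y hy)
    simpa using key 1 hone
  · intro x hx
    refine Submodule.span_induction
      (p := fun x _ => x ∈ Algebra.adjoin 𝕜 {lamSeries 𝕜, pSeries g H 0}) ?_ ?_ ?_ ?_ hx
    · rintro _ (⟨m, rfl⟩ | ⟨j, rfl⟩)
      · exact pow_mem hlam m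
      · obtain ⟨α, -, -, hα⟩ := exists_monic_mul_pSeries hH j
        simp only [hα]
        refine mul_mem ?_ hp0
        exact Algebra.adjoin_mono (by simp) (Polynomial.aeval_mem_adjoin_singleton 𝕜 _)
    · exact zero_mem _
    · intro x y _ _ hx hy; exact add_mem hx hy
    · intro c x _ hx
      rw [← HahnSeries.C_mul_eq_smul, ← algebraMap_laurentSeries]
      exact mul_mem (Subalgebra.algebraMap_mem _ c) hx

lemma aeval_lamSeries_injective :
    Function.Injective (Polynomial.aeval (R := 𝕜) (lamSeries 𝕜)) := by
  rw [injective_iff_map_eq_zero]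
  intro A hA
  ext n
  have : (Polynomial.aeval (lamSeries 𝕜) A).coeff (-2 * (n : ℤ)) = A.coeff n := by
    rw [Polynomial.aeval_def, Polynomial.eval₂_eq_sum_range, HahnSeries.coeff_sum]
    simp only [lamSeries_pow, algebraMap_laurentSeries, HahnSeries.C_mul_eq_smul,
      HahnSeries.coeff_smul, HahnSeries.coeff_single]
    rw [Finset.sum_eq_single n]
    · simp
    · intro m _ hm
      rw [if_neg (by omega), smul_zero]
    · intro hn
      rw [Polynomial.coeff_eq_zero_of_natDegree_lt (by simpa using hn), zero_smul]
  rw [← this, hA]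
  simp

lemma natDegree_curvePoly (g : ℕ) (u : Fin (2 * g + 1) → 𝕜) :
    (curvePoly g u).natDegree = 2 * g + 1 := by
  have h : (∑ k : Fin (2 * g + 1), Polynomial.C (u k) * Polynomial.X ^ (k : ℕ)).degree
      < ((2 * g + 1 : ℕ) : WithBot ℕ) := by
    refine (Polynomial.degree_sum_le _ _).trans_lt ?_
    rw [Finset.sup_lt_iff (WithBot.bot_lt_coe _)]
    intro k _
    refine (Polynomial.degree_C_mul_X_pow_le _ _).trans_lt ?_
    exact_mod_cast k.2
  refine Polynomial.natDegree_eq_of_degree_eq_some ?_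
  rw [curvePoly, Polynomial.degree_add_eq_left_of_degree_lt, Polynomial.degree_X_pow]
  rwa [Polynomial.degree_X_pow]

/-- `1` and a square root of a polynomial of odd degree are linearly independent over `𝕜[λ]`: the
two sides of `A² = B² P` have degrees of different parity. -/
lemma eq_zero_of_sq_eq_sq_mul {A B P : Polynomial 𝕜} (hP : Odd P.natDegree)
    (h : A ^ 2 = B ^ 2 * P) : A = 0 ∧ B = 0 := by
  have hP0 : P ≠ 0 := by rintro rfl; simp at hP
  by_cases hB : B = 0
  · subst hB
    simpa using h
  · exfalso
    have := congrArg Polynomial.natDegree h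
    rw [Polynomial.natDegree_mul (pow_ne_zero 2 hB) hP0, Polynomial.natDegree_pow,
      Polynomial.natDegree_pow] at this
    obtain ⟨m, hm⟩ := hP
    omega

/-- The algebra generated by `λ` and `p_{2g+1}` is the coordinate ring of the affine curve. -/
lemma exists_curveRing_equiv [CharZero 𝕜] {g : ℕ} {H : ℕ → ℕ → 𝕜} (hH : H ∈ Wgc 𝕜 g) :
    ∃ e : CurveRing g (curveCoeff g (baseCoords g H)) ≃ₐ[𝕜]
        Algebra.adjoin 𝕜 {lamSeries 𝕜, pSeries g H 0},
      (e (AdjoinRoot.of _ Polynomial.X) : LaurentSeries 𝕜) = lamSeries 𝕜 ∧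
      (e (AdjoinRoot.root _) : LaurentSeries 𝕜) = pSeries g H 0 := by
  set P := curvePoly g (curveCoeff g (baseCoords g H)) with hP
  have hsq : pSeries g H 0 ^ 2 = Polynomial.aeval (lamSeries 𝕜) P := pSeries_sq hH
  let φ : AdjoinRoot (Polynomial.X ^ 2 - Polynomial.C P : Polynomial (Polynomial 𝕜)) →ₐ[𝕜]
      LaurentSeries 𝕜 :=
    AdjoinRoot.liftAlgHom _ (Polynomial.aeval (lamSeries 𝕜)) (pSeries g H 0) (by
      simp [hsq])
  have hφX : φ (AdjoinRoot.of _ Polynomial.X) = lamSeries 𝕜 := by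
    simp [φ]
  have hφr : φ (AdjoinRoot.root _) = pSeries g H 0 := by
    simp [φ]
  have hmonic : (Polynomial.X ^ 2 - Polynomial.C P : Polynomial (Polynomial 𝕜)).Monic :=
    Polynomial.monic_X_pow_sub_C P two_ne_zero
  have hinj : Function.Injective φ := by
    rw [injective_iff_map_eq_zero]
    intro x hx
    obtain ⟨q, rfl⟩ := AdjoinRoot.mk_surjective x
    have hmod : AdjoinRoot.mk (Polynomial.X ^ 2 - Polynomial.C P) q
        = AdjoinRoot.mk (Polynomial.X ^ 2 - Polynomial.C P)
          (q %ₘ (Polynomial.X ^ 2 - Polynomial.C P)) := by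
      rw [AdjoinRoot.mk_eq_mk]
      exact ⟨_, (sub_eq_iff_eq_add'.2 (Polynomial.modByMonic_add_div q _).symm)⟩
    rw [hmod] at hx ⊢
    have hdeg := Polynomial.degree_modByMonic_lt q hmonic
    rw [Polynomial.degree_X_pow_sub_C (by norm_num)] at hdeg
    set r := q %ₘ (Polynomial.X ^ 2 - Polynomial.C P) with hr
    have hr2 : r = Polynomial.C (r.coeff 1) * Polynomial.X + Polynomial.C (r.coeff 0) := by
      refine Polynomial.eq_X_add_C_of_degree_le_one ?_
      exact Order.le_of_lt_succ (by exact_mod_cast hdeg)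
    rw [hr2] at hx
    simp only [φ, AdjoinRoot.liftAlgHom_mk, Polynomial.eval₂_add, Polynomial.eval₂_mul,
      Polynomial.eval₂_C, Polynomial.eval₂_X] at hx
    -- multiplication of `A + B p = 0` by `A - B p` eliminates `p`
    have hAB : (r.coeff 0) ^ 2 = (r.coeff 1) ^ 2 * P := by
      apply aeval_lamSeries_injective (𝕜 := 𝕜)
      rw [map_pow, map_mul, map_pow, ← hsq]
      replace hx : Polynomial.aeval (lamSeries 𝕜) (r.coeff 1) * pSeries g H 0
        + Polynomial.aeval (lamSeries 𝕜) (r.coeff 0) = 0 := hx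
      linear_combination (Polynomial.aeval (lamSeries 𝕜) (r.coeff 0)
        - Polynomial.aeval (lamSeries 𝕜) (r.coeff 1) * pSeries g H 0) * hx
    have hodd : Odd P.natDegree := by
      rw [hP, natDegree_curvePoly]
      exact ⟨g, rfl⟩
    obtain ⟨h0, h1⟩ := eq_zero_of_sq_eq_sq_mul hodd hAB
    rw [hr2, h0, h1]
    simp
  have hrange : φ.range = Algebra.adjoin 𝕜 {lamSeries 𝕜, pSeries g H 0} := by
    refine le_antisymm ?_ ?_
    · rintro _ ⟨x, rfl⟩
      obtain ⟨q, rfl⟩ := AdjoinRoot.mk_surjective x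
      simp only [φ, AlgHom.toRingHom_eq_coe, RingHom.coe_coe, AdjoinRoot.liftAlgHom_mk]
      rw [Polynomial.eval₂_eq_sum_range]
      refine sum_mem fun n _ => mul_mem ?_ (pow_mem (Algebra.subset_adjoin (by simp)) n)
      exact Algebra.adjoin_mono (by simp)
        (Polynomial.aeval_mem_adjoin_singleton 𝕜 (lamSeries 𝕜))
    · rw [Algebra.adjoin_le_iff]
      rintro _ (rfl | rfl)
      · exact ⟨_, hφX⟩
      · exact ⟨_, hφr⟩
  exact ⟨(AlgEquiv.ofInjective φ hinj).trans (Subalgebra.equivOfEq _ _ hrange), hφX, hφr⟩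

end Laurent

/-! ### Polynomial maps and their Jacobians -/

section PolyMap

variable {𝕜 : Type*} [RCLike 𝕜] {n : ℕ}

/-- The polynomial map with components `p`. -/
noncomputable def polyMap (p : Fin n → MvPolynomial (Fin n) 𝕜) (v : Fin n → 𝕜) : Fin n → 𝕜 :=
  fun i => MvPolynomial.eval v (p i)

/-- The matrix of partial derivatives of a polynomial map. -/
noncomputable def polyJac (p : Fin n → MvPolynomial (Fin n) 𝕜) :
    Matrix (Fin n) (Fin n) (MvPolynomial (Fin n) 𝕜) :=
  Matrix.of fun i m => MvPolynomial.pderiv m (p i)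

lemma hasFDerivAt_eval (p : MvPolynomial (Fin n) 𝕜) (v : Fin n → 𝕜) :
    HasFDerivAt (fun v => MvPolynomial.eval v p)
      (∑ m, MvPolynomial.eval v (MvPolynomial.pderiv m p) •
        (ContinuousLinearMap.proj m : (Fin n → 𝕜) →L[𝕜] 𝕜)) v := by
  induction p using MvPolynomial.induction_on with
  | C a =>
    have h : HasFDerivAt (fun _ : Fin n → 𝕜 => a) (0 : (Fin n → 𝕜) →L[𝕜] 𝕜) v :=
      hasFDerivAt_const a v
    simp only [MvPolynomial.eval_C]
    refine h.congr_fderiv ?_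
    ext w
    simp
  | add p q hp hq =>
    have h := hp.add hq
    simp only [map_add]
    refine h.congr_fderiv ?_
    ext w
    simp [add_mul, Finset.sum_add_distrib]
  | mul_X p i hp =>
    have h := hp.mul (ContinuousLinearMap.proj (R := 𝕜) (φ := fun _ : Fin n => 𝕜) i).hasFDerivAt
      (x := v)
    simp only [map_mul, MvPolynomial.eval_X]
    refine h.congr_fderiv ?_
    ext w
    simp [Pi.single_apply, apply_ite (MvPolynomial.eval v)]
    simp [add_mul, Finset.sum_add_distrib, ite_mul, mul_assoc, ← Finset.mul_sum]

lemma fderiv_eval_apply (p : MvPolynomial (Fin n) 𝕜) (v w : Fin n → 𝕜) :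
    fderiv 𝕜 (fun v => MvPolynomial.eval v p) v w
      = ∑ m, MvPolynomial.eval v (MvPolynomial.pderiv m p) * w m := by
  rw [(hasFDerivAt_eval p v).fderiv]
  simp

lemma contDiff_eval (p : MvPolynomial (Fin n) 𝕜) {m : ℕ∞} :
    ContDiff 𝕜 m (fun v : Fin n → 𝕜 => MvPolynomial.eval v p) := by
  induction p using MvPolynomial.induction_on with
  | C a => simpa using contDiff_const
  | add p q hp hq => simpa using hp.add hq
  | mul_X p i hp => simpa using hp.mul (contDiff_apply 𝕜 𝕜 i)

lemma contDiff_polyMap (p : Fin n → MvPolynomial (Fin n) 𝕜) {m : ℕ∞} :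
    ContDiff 𝕜 m (polyMap p) :=
  contDiff_pi.2 fun i => contDiff_eval (p i)

lemma differentiable_polyMap (p : Fin n → MvPolynomial (Fin n) 𝕜) :
    Differentiable 𝕜 (polyMap p) :=
  (contDiff_polyMap p (m := 1)).differentiable one_ne_zero

lemma fderiv_polyMap_apply (p : Fin n → MvPolynomial (Fin n) 𝕜) (v w : Fin n → 𝕜) (i : Fin n) :
    fderiv 𝕜 (polyMap p) v w i = fderiv 𝕜 (fun v => MvPolynomial.eval v (p i)) v w := by
  have h : HasFDerivAt (polyMap p) (ContinuousLinearMap.pi fun i =>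
      fderiv 𝕜 (fun v => MvPolynomial.eval v (p i)) v) v :=
    hasFDerivAt_pi.2 fun i => (hasFDerivAt_eval (p i) v).differentiableAt.hasFDerivAt
  rw [h.fderiv]
  rfl

lemma fderiv_polyMap_eq_mulVec (p : Fin n → MvPolynomial (Fin n) 𝕜) (v w : Fin n → 𝕜) :
    fderiv 𝕜 (polyMap p) v w = ((polyJac p).map (MvPolynomial.eval v)).mulVec w := by
  ext i
  rw [fderiv_polyMap_apply, fderiv_eval_apply]
  rfl

/-- A derivation of the polynomial ring, evaluated at a point, is the directional derivative along
the values of the derivation on the variables. -/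
lemma eval_derivation (D : Derivation 𝕜 (MvPolynomial (Fin n) 𝕜) (MvPolynomial (Fin n) 𝕜))
    (p : MvPolynomial (Fin n) 𝕜) (v : Fin n → 𝕜) :
    MvPolynomial.eval v (D p) = fderiv 𝕜 (fun v => MvPolynomial.eval v p) v
      (fun m => MvPolynomial.eval v (D (MvPolynomial.X m))) := by
  have h : D p = ∑ m, MvPolynomial.pderiv m p * D (MvPolynomial.X m) := by
    induction p using MvPolynomial.induction_on with
    | C a => simp [MvPolynomial.derivation_C]
    | add p q hp hq => simp only [map_add, add_mul, Finset.sum_add_distrib, hp, hq]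
    | mul_X p i hp =>
      simp only [Derivation.leibniz, smul_eq_mul, hp, add_mul, Finset.sum_add_distrib, mul_assoc,
        ← Finset.mul_sum]
      simp [MvPolynomial.pderiv_X, Pi.single_apply]
  simp only [fderiv_eval_apply, h, map_sum, map_mul]

end PolyMap

/-! ### The polynomials of the hierarchy -/

section Hierarchy

variable (𝕜 : Type*) [RCLike 𝕜] (g : ℕ)

/-- The base row of the generic point of `W_{gc}`. -/
noncomputable def genericRoot : ℕ → MvPolynomial (Fin (2 * g + 1)) 𝕜 :=
  rootSeq 𝕜 g MvPolynomial.X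

/-- The polynomials `F k i` expressing the coefficients `H k i` in terms of `v`. -/
noncomputable def tablePoly (k i : Fin (2 * g + 1)) : MvPolynomial (Fin (2 * g + 1)) 𝕜 :=
  tableOf (genericRoot 𝕜 g) k i

/-- The coefficients of the curve as polynomials in `v`. -/
noncomputable def curvePolys (s : Fin (2 * g + 1)) : MvPolynomial (Fin (2 * g + 1)) 𝕜 :=
  curveMap g MvPolynomial.X s

/-- The coordinates `v` as polynomials in the coefficients of the curve. -/
noncomputable def rootPolys (i : Fin (2 * g + 1)) : MvPolynomial (Fin (2 * g + 1)) 𝕜 :=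
  sqrtSeq 𝕜 (curveSeq g MvPolynomial.X) i

/-- The matrices of the systems for `u`: the Jacobian of `F k` in the coordinates `u`. -/
noncomputable def hydroMatrix (k : Fin (2 * g + 1)) :
    Matrix (Fin (2 * g + 1)) (Fin (2 * g + 1)) (MvPolynomial (Fin (2 * g + 1)) 𝕜) :=
  (polyJac (curvePolys 𝕜 g)).map (MvPolynomial.aeval (rootPolys 𝕜 g))
    * (polyJac (tablePoly 𝕜 g k)).map (MvPolynomial.aeval (rootPolys 𝕜 g))
    * polyJac (rootPolys 𝕜 g)

variable {𝕜 g}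

lemma eval_table_genericRoot (v : Fin (2 * g + 1) → 𝕜) (k i : ℕ) :
    MvPolynomial.eval v (tableOf (genericRoot 𝕜 g) k i) = tableOf (rootSeq 𝕜 g v) k i := by
  rw [map_tableOf]
  congr 1
  funext m
  have := map_rootSeq (𝕜 := 𝕜) g (MvPolynomial.aeval v) (MvPolynomial.X (R := 𝕜)) m
  simpa [genericRoot, MvPolynomial.coe_aeval_eq_eval] using this

lemma eval_tablePoly_zero (v : Fin (2 * g + 1) → 𝕜) (i : Fin (2 * g + 1)) :
    MvPolynomial.eval v (tablePoly 𝕜 g 0 i) = v i := by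
  rw [tablePoly, eval_table_genericRoot]
  exact rootSeq_val 𝕜 g v i

lemma polyMap_curvePolys (v : Fin (2 * g + 1) → 𝕜) :
    polyMap (curvePolys 𝕜 g) v = curveMap g v := by
  funext s
  have := map_curveMap g (MvPolynomial.eval v) (MvPolynomial.X (R := 𝕜)) s
  simpa [polyMap, curvePolys] using this

lemma polyMap_rootPolys (u : Fin (2 * g + 1) → 𝕜) :
    polyMap (rootPolys 𝕜 g) u = fun i : Fin (2 * g + 1) => sqrtSeq 𝕜 (curveSeq g u) i := by
  funext i
  have := map_sqrtSeq (𝕜 := 𝕜) (MvPolynomial.aeval u) (curveSeq g (MvPolynomial.X (R := 𝕜))) i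
  simp only [MvPolynomial.aeval_eq_eval, map_curveSeq, MvPolynomial.eval_X] at this
  exact this

lemma curve_root (u : Fin (2 * g + 1) → 𝕜) :
    polyMap (curvePolys 𝕜 g) (polyMap (rootPolys 𝕜 g) u) = u := by
  rw [polyMap_curvePolys, polyMap_rootPolys, curveMap_sqrtSeq]

lemma root_curve (v : Fin (2 * g + 1) → 𝕜) :
    polyMap (rootPolys 𝕜 g) (polyMap (curvePolys 𝕜 g) v) = v := by
  rw [polyMap_curvePolys, polyMap_rootPolys]
  funext i
  exact rootSeq_val 𝕜 g v i

lemma fderiv_curve_root (u w : Fin (2 * g + 1) → 𝕜) :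
    fderiv 𝕜 (polyMap (curvePolys 𝕜 g)) (polyMap (rootPolys 𝕜 g) u)
      (fderiv 𝕜 (polyMap (rootPolys 𝕜 g)) u w) = w := by
  have h := ((differentiable_polyMap (curvePolys 𝕜 g)) (polyMap (rootPolys 𝕜 g) u)).hasFDerivAt.comp
    u ((differentiable_polyMap (rootPolys 𝕜 g)) u).hasFDerivAt
  have e : polyMap (curvePolys 𝕜 g) ∘ polyMap (rootPolys 𝕜 g) = id := funext curve_root
  rw [e] at h
  exact congrArg (· w) (h.unique (hasFDerivAt_id u))

lemma fderiv_root_curve (v w : Fin (2 * g + 1) → 𝕜) :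
    fderiv 𝕜 (polyMap (rootPolys 𝕜 g)) (polyMap (curvePolys 𝕜 g) v)
      (fderiv 𝕜 (polyMap (curvePolys 𝕜 g)) v w) = w := by
  have h := ((differentiable_polyMap (rootPolys 𝕜 g)) (polyMap (curvePolys 𝕜 g) v)).hasFDerivAt.comp
    v ((differentiable_polyMap (curvePolys 𝕜 g)) v).hasFDerivAt
  have e : polyMap (rootPolys 𝕜 g) ∘ polyMap (curvePolys 𝕜 g) = id := funext root_curve
  rw [e] at h
  exact congrArg (· w) (h.unique (hasFDerivAt_id v))

lemma hydroMatrix_mulVec (k : Fin (2 * g + 1)) (u w : Fin (2 * g + 1) → 𝕜) :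
    ((hydroMatrix 𝕜 g k).map (MvPolynomial.eval u)).mulVec w
      = fderiv 𝕜 (polyMap (curvePolys 𝕜 g)) (polyMap (rootPolys 𝕜 g) u)
          (fderiv 𝕜 (polyMap (tablePoly 𝕜 g k)) (polyMap (rootPolys 𝕜 g) u)
            (fderiv 𝕜 (polyMap (rootPolys 𝕜 g)) u w)) := by
  have e : ∀ M : Matrix (Fin (2 * g + 1)) (Fin (2 * g + 1)) (MvPolynomial (Fin (2 * g + 1)) 𝕜),
      (M.map (MvPolynomial.aeval (rootPolys 𝕜 g))).map (MvPolynomial.eval u)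
        = M.map (MvPolynomial.eval (polyMap (rootPolys 𝕜 g) u)) := by
    intro M
    ext i j
    simp only [Matrix.map_apply]
    exact MvPolynomial.comp_aeval_apply (rootPolys 𝕜 g) (MvPolynomial.aeval u) (M i j)
  rw [fderiv_polyMap_eq_mulVec, fderiv_polyMap_eq_mulVec, fderiv_polyMap_eq_mulVec, hydroMatrix,
    Matrix.map_mul, Matrix.map_mul, e, e, Matrix.mulVec_mulVec, Matrix.mulVec_mulVec,
    Matrix.mul_assoc]

/-- The derivation of the polynomial ring that generates the `k`-th flow: it sends `v_i` to
the derivative of `F k i` along `ξ`. -/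
noncomputable def flowDerivation (ξ : Fin (2 * g + 1) → 𝕜) (k : Fin (2 * g + 1)) :
    Derivation 𝕜 (MvPolynomial (Fin (2 * g + 1)) 𝕜) (MvPolynomial (Fin (2 * g + 1)) 𝕜) :=
  MvPolynomial.mkDerivation 𝕜 fun i =>
    MvPolynomial.mkDerivation 𝕜 (fun m => MvPolynomial.C (ξ m)) (tablePoly 𝕜 g k i)

/-- The generic square root evolves by `λ^{-k} D_k h = (a_k h)'`. -/
lemma genericRoot_flow (ξ : Fin (2 * g + 1) → 𝕜) (k : Fin (2 * g + 1)) :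
    PowerSeries.X ^ (k : ℕ) * PowerSeries.coeffDerivation (flowDerivation ξ k)
        (oneSeries (genericRoot 𝕜 g))
      = PowerSeries.coeffDerivation (MvPolynomial.mkDerivation 𝕜 fun m => MvPolynomial.C (ξ m))
          ((PowerSeries.trunc ((k : ℕ) + 1) (invSeries (genericRoot 𝕜 g)) : PowerSeries _)
            * oneSeries (genericRoot 𝕜 g)) := by
  have h2 : IsUnit (2 : MvPolynomial (Fin (2 * g + 1)) 𝕜) := by
    have := (IsUnit.mk0 (2 : 𝕜) two_ne_zero).map
      (MvPolynomial.C (R := 𝕜) (σ := Fin (2 * g + 1)))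
    rwa [map_ofNat] at this
  refine PowerSeries.flow_of_trunc_flow h2 _ _ (invSeries_mul _)
    (degLE_oneSeries_rootSeq_sq 𝕜 g MvPolynomial.X) (PowerSeries.DegLE.trunc _ _) ?_
  rw [trunc_mul_oneSeries]
  have e : ∀ D : Derivation 𝕜 (MvPolynomial (Fin (2 * g + 1)) 𝕜)
      (MvPolynomial (Fin (2 * g + 1)) 𝕜),
      PowerSeries.coeffDerivation D (oneSeries (genericRoot 𝕜 g))
        = PowerSeries.X ^ 1 * PowerSeries.coeffDerivation D
            (PowerSeries.mk (genericRoot 𝕜 g)) := by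
    intro D
    rw [oneSeries, map_add, Derivation.map_one_eq_zero, zero_add,
      ← PowerSeries.coeffDerivation_X_pow_mul, pow_one]
  rw [e, map_add, Derivation.map_one_eq_zero, zero_add, PowerSeries.coeffDerivation_X_pow_mul,
    ← mul_assoc, ← pow_add, ← mul_sub, show 2 * g + 1 + (k : ℕ) + 1 = (k + 1) + (2 * g + 1) by ring,
    pow_add _ ((k : ℕ) + 1)]
  refine mul_dvd_mul_left _ ?_
  rw [PowerSeries.X_pow_dvd_iff]
  intro m hm
  rw [map_sub, PowerSeries.coeff_coeffDerivation, PowerSeries.coeff_coeffDerivation,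
    PowerSeries.coeff_mk, PowerSeries.coeff_mk, sub_eq_zero]
  have hr : genericRoot 𝕜 g m = MvPolynomial.X ⟨m, hm⟩ :=
    rootSeq_val 𝕜 g MvPolynomial.X ⟨m, hm⟩
  rw [hr, flowDerivation, MvPolynomial.mkDerivation_X]
  rfl

lemma eval_mkDerivation_C (ξ v : Fin (2 * g + 1) → 𝕜) (p : MvPolynomial (Fin (2 * g + 1)) 𝕜) :
    MvPolynomial.eval v (MvPolynomial.mkDerivation 𝕜 (fun m => MvPolynomial.C (ξ m)) p)
      = fderiv 𝕜 (fun v => MvPolynomial.eval v p) v ξ := by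
  rw [eval_derivation]
  simp [MvPolynomial.mkDerivation_X]

lemma eval_flowDerivation_X (ξ v : Fin (2 * g + 1) → 𝕜) (k i : Fin (2 * g + 1)) :
    MvPolynomial.eval v (flowDerivation ξ k (MvPolynomial.X i))
      = fderiv 𝕜 (polyMap (tablePoly 𝕜 g k)) v ξ i := by
  rw [flowDerivation, MvPolynomial.mkDerivation_X, eval_mkDerivation_C, fderiv_polyMap_apply]

/-- The Jacobians of the polynomial maps `F k` and `F l` commute. -/
lemma fderiv_tablePoly_comm (k l : Fin (2 * g + 1)) (v ξ : Fin (2 * g + 1) → 𝕜) :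
    fderiv 𝕜 (polyMap (tablePoly 𝕜 g k)) v (fderiv 𝕜 (polyMap (tablePoly 𝕜 g l)) v ξ)
      = fderiv 𝕜 (polyMap (tablePoly 𝕜 g l)) v
          (fderiv 𝕜 (polyMap (tablePoly 𝕜 g k)) v ξ) := by
  have hs := PowerSeries.flows_symmetric _ _ _ (invSeries_mul (genericRoot 𝕜 g)) k l
    (genericRoot_flow ξ k) (genericRoot_flow ξ l)
  have hcoeff : ∀ i : Fin (2 * g + 1), flowDerivation ξ k (tablePoly 𝕜 g l i)
      = flowDerivation ξ l (tablePoly 𝕜 g k i) := by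
    intro i
    rw [trunc_mul_oneSeries, trunc_mul_oneSeries, map_add, map_add, Derivation.map_one_eq_zero,
      Derivation.map_one_eq_zero, zero_add, zero_add, PowerSeries.coeffDerivation_X_pow_mul,
      PowerSeries.coeffDerivation_X_pow_mul, ← mul_assoc, ← mul_assoc, ← pow_add, ← pow_add] at hs
    have := congrArg (PowerSeries.coeff ((k : ℕ) + (l + 1) + i)) hs
    rw [PowerSeries.coeff_X_pow_mul', PowerSeries.coeff_X_pow_mul', if_pos (by omega),
      if_pos (by omega), Nat.add_sub_cancel_left,
      show (k : ℕ) + (l + 1) + i - (l + (k + 1)) = i by omega,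
      PowerSeries.coeff_coeffDerivation, PowerSeries.coeff_coeffDerivation,
      PowerSeries.coeff_mk, PowerSeries.coeff_mk] at this
    exact this
  funext i
  have := congrArg (MvPolynomial.eval v) (hcoeff i)
  rw [eval_derivation, eval_derivation] at this
  simp only [eval_flowDerivation_X] at this
  rw [fderiv_polyMap_apply, fderiv_polyMap_apply]
  exact this.symm

end Hierarchy

/-! ### The first flow -/

section FirstFlow

variable {𝕜 : Type*} [RCLike 𝕜] {g : ℕ}

lemma tablePoly_one_castSucc (hg : 1 ≤ g) (i : Fin (2 * g)) :
    tablePoly 𝕜 g 1 i.castSucc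
      = MvPolynomial.X i.succ - MvPolynomial.X 0 * MvPolynomial.X i.castSucc := by
  have h1 : ((1 : Fin (2 * g + 1)) : ℕ) = 1 := by
    rw [Fin.val_one', Nat.mod_eq_of_lt (by omega)]
  have hr : ∀ m : Fin (2 * g + 1), genericRoot 𝕜 g m = MvPolynomial.X m :=
    rootSeq_val 𝕜 g MvPolynomial.X
  rw [tablePoly, h1]
  simp only [tableOf]
  rw [← hr, ← hr, ← hr]
  rfl

lemma tablePoly_one_last (hg : 1 ≤ g) :
    tablePoly 𝕜 g 1 (Fin.last (2 * g)) =
      - MvPolynomial.C (1 / 2 : 𝕜) * (∑ a, MvPolynomial.X a * MvPolynomial.X (Fin.rev a))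
        - MvPolynomial.X 0 * MvPolynomial.X (Fin.last (2 * g)) := by
  have h1 : ((1 : Fin (2 * g + 1)) : ℕ) = 1 := by
    rw [Fin.val_one', Nat.mod_eq_of_lt (by omega)]
  have hr : ∀ m : Fin (2 * g + 1), genericRoot 𝕜 g m = MvPolynomial.X m :=
    rootSeq_val 𝕜 g MvPolynomial.X
  have hlast : genericRoot 𝕜 g (2 * g + 1)
      = - MvPolynomial.C (1 / 2 : 𝕜) * ∑ a, MvPolynomial.X a * MvPolynomial.X (Fin.rev a) := by
    rw [genericRoot, rootSeq, sqrtSeq_eq, curveSeq_of_le g _ le_rfl, zero_sub, smul_neg,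
      MvPolynomial.smul_eq_C_mul, neg_mul, Finset.sum_range]
    congr 2
    refine Finset.sum_congr rfl fun a _ => ?_
    rw [← hr, ← hr, Fin.val_rev, show 2 * g + 1 - ((a : ℕ) + 1) = 2 * g + 1 - 1 - a by omega]
    rfl
  rw [tablePoly, h1]
  simp only [tableOf, Fin.val_last]
  rw [hlast, ← hr 0, ← hr (Fin.last (2 * g))]
  rfl

/-- The first flow of the square `c = h²`: comparing coefficients in
`λ⁻¹ D_1 (h²) = 2 a_1' h² + a_1 (h²)'` with `a_1 = 1 - v_0 λ⁻¹`. -/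
lemma flowDerivation_one_curveSeq (hg : 1 ≤ g) (ξ : Fin (2 * g + 1) → 𝕜) (n : ℕ) :
    flowDerivation ξ 1 (curveSeq g (curvePolys 𝕜 g) n)
      = MvPolynomial.mkDerivation 𝕜 (fun m => MvPolynomial.C (ξ m))
          (curveSeq g (curvePolys 𝕜 g) (n + 1))
        - genericRoot 𝕜 g 0 * MvPolynomial.mkDerivation 𝕜 (fun m => MvPolynomial.C (ξ m))
          (curveSeq g (curvePolys 𝕜 g) n)
        - 2 * curveSeq g (curvePolys 𝕜 g) n *
          MvPolynomial.mkDerivation 𝕜 (fun m => MvPolynomial.C (ξ m)) (genericRoot 𝕜 g 0) := by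
  have h1 : ((1 : Fin (2 * g + 1)) : ℕ) = 1 := by
    rw [Fin.val_one', Nat.mod_eq_of_lt (by omega)]
  have hf := genericRoot_flow ξ (1 : Fin (2 * g + 1))
  rw [h1, pow_one] at hf
  set r := genericRoot 𝕜 g with hr
  set c := curveSeq g (curvePolys 𝕜 g) with hc
  set D : Derivation 𝕜 (MvPolynomial (Fin (2 * g + 1)) 𝕜) (MvPolynomial (Fin (2 * g + 1)) 𝕜) :=
    MvPolynomial.mkDerivation 𝕜 fun m => MvPolynomial.C (ξ m) with hDdef
  set E := flowDerivation ξ (1 : Fin (2 * g + 1)) with hE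
  have hsq : oneSeries r ^ 2 = oneSeries c := oneSeries_rootSeq_sq 𝕜 g MvPolynomial.X
  have ha : (PowerSeries.trunc (1 + 1) (invSeries r) :
      PowerSeries (MvPolynomial (Fin (2 * g + 1)) 𝕜))
      = 1 - PowerSeries.X * PowerSeries.C (r 0) := by
    have hT := mk_tableOf r 0
    simp only [tableOf] at hT
    have hT' : PowerSeries.mk (tableOf r 1)
        = PowerSeries.mk fun l => r (l + 1) - r 0 * r l := rfl
    have h := trunc_mul_oneSeries r 1
    have h' : (1 - PowerSeries.X * PowerSeries.C (r 0)) * oneSeries r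
        = 1 + PowerSeries.X ^ (1 + 1) * PowerSeries.mk (tableOf r 1) := by
      have : oneSeries r = 1 + PowerSeries.X * PowerSeries.mk r := rfl
      rw [sub_mul, one_mul]
      rw [hT']
      linear_combination this + PowerSeries.X * hT
    have hu := invSeries_mul r
    linear_combination invSeries r * (h - h')
      - ((PowerSeries.trunc (1 + 1) (invSeries r) : PowerSeries (MvPolynomial (Fin (2 * g + 1)) 𝕜))
        - (1 - PowerSeries.X * PowerSeries.C (r 0))) * hu
  have hDone : ∀ D' : Derivation 𝕜 (MvPolynomial (Fin (2 * g + 1)) 𝕜)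
      (MvPolynomial (Fin (2 * g + 1)) 𝕜), PowerSeries.coeffDerivation D' (oneSeries c)
        = PowerSeries.X * PowerSeries.coeffDerivation D' (PowerSeries.mk c) := by
    intro D'
    rw [oneSeries, map_add, Derivation.map_one_eq_zero, zero_add, ← pow_one PowerSeries.X,
      PowerSeries.coeffDerivation_X_pow_mul]
  have hDa : PowerSeries.coeffDerivation D (1 - PowerSeries.X * PowerSeries.C (r 0))
      = - (PowerSeries.X * PowerSeries.C (D (r 0))) := by
    rw [map_sub, Derivation.map_one_eq_zero, zero_sub, ← pow_one PowerSeries.X,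
      PowerSeries.coeffDerivation_X_pow_mul]
    congr 2
    ext1 m
    rw [PowerSeries.coeff_coeffDerivation, PowerSeries.coeff_C, PowerSeries.coeff_C]
    split_ifs <;> simp
  have hflow : PowerSeries.X * (PowerSeries.X * PowerSeries.coeffDerivation E (PowerSeries.mk c))
      = PowerSeries.X * ((1 - PowerSeries.X * PowerSeries.C (r 0))
          * PowerSeries.coeffDerivation D (PowerSeries.mk c)
          - 2 * PowerSeries.C (D (r 0)) * oneSeries c) := by
    have h2 : ∀ D' : Derivation 𝕜 (MvPolynomial (Fin (2 * g + 1)) 𝕜)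
        (MvPolynomial (Fin (2 * g + 1)) 𝕜), PowerSeries.coeffDerivation D' (oneSeries c)
          = 2 * oneSeries r * PowerSeries.coeffDerivation D' (oneSeries r) := by
      intro D'
      rw [← hsq, Derivation.leibniz_pow]
      simp only [smul_eq_mul, nsmul_eq_mul]
      push_cast
      ring
    rw [ha, Derivation.leibniz, hDa, smul_eq_mul, smul_eq_mul] at hf
    have hE2 := h2 E
    have hD2 := h2 D
    rw [hDone] at hE2 hD2
    linear_combination PowerSeries.X * hE2 + 2 * oneSeries r * hf
      - (1 - PowerSeries.X * PowerSeries.C (r 0)) * hD2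
      - 2 * PowerSeries.X * PowerSeries.C (D (r 0)) * hsq
  have := congrArg (PowerSeries.coeff (n + 1 + 1)) hflow
  rw [PowerSeries.coeff_succ_X_mul, PowerSeries.coeff_succ_X_mul, PowerSeries.coeff_succ_X_mul,
    map_sub, sub_mul, one_mul, map_sub, mul_assoc, PowerSeries.coeff_succ_X_mul,
    PowerSeries.coeff_C_mul, mul_assoc, ← map_ofNat (PowerSeries.C), PowerSeries.coeff_C_mul,
    PowerSeries.coeff_C_mul, coeff_oneSeries] at this
  simp only [PowerSeries.coeff_coeffDerivation, PowerSeries.coeff_mk] at this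
  rw [this]
  ring

/-- The first system for `u` is the dispersionless coupled KdV system. -/
lemma hydroRHS_hydroMatrix_one (hg : 1 ≤ g) (u w : Fin (2 * g + 1) → 𝕜) (j : Fin (2 * g + 1)) :
    hydroRHS (hydroMatrix 𝕜 g 1) (u, w) j =
      (if j = 0 then 0 else w (j - 1)) - (1 / 2) * u (Fin.last (2 * g)) * w j
        - u j * w (Fin.last (2 * g)) := by
  have h0 : hydroRHS (hydroMatrix 𝕜 g 1) (u, w) j
      = ((hydroMatrix 𝕜 g 1).map (MvPolynomial.eval u)).mulVec w j := rfl
  rw [h0, hydroMatrix_mulVec]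
  set v := polyMap (rootPolys 𝕜 g) u with hv
  set ξ := fderiv 𝕜 (polyMap (rootPolys 𝕜 g)) u w with hξ
  have hDx : ∀ i, MvPolynomial.eval v
      (MvPolynomial.mkDerivation 𝕜 (fun m => MvPolynomial.C (ξ m)) (curvePolys 𝕜 g i)) = w i := by
    intro i
    rw [eval_mkDerivation_C, ← fderiv_polyMap_apply, hξ, hv, fderiv_curve_root]
  have hu : ∀ i, MvPolynomial.eval v (curvePolys 𝕜 g i) = u i := fun i => congrFun (curve_root u) i
  have hroot : 2 * genericRoot 𝕜 g 0 = curvePolys 𝕜 g (Fin.last (2 * g)) := by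
    have h := sqrtSeq_sq 𝕜 (curveSeq g (curveMap g (MvPolynomial.X (R := 𝕜)))) 0
    have h' := curveSeq_val g (curvePolys 𝕜 g) 0
    rw [Finset.range_zero, Finset.sum_empty, add_zero] at h
    rw [Fin.rev_zero] at h'
    exact h.trans h'
  have hroot' : genericRoot 𝕜 g 0
      = MvPolynomial.C (1 / 2 : 𝕜) * curvePolys 𝕜 g (Fin.last (2 * g)) := by
    rw [← hroot, ← mul_assoc, ← map_ofNat (MvPolynomial.C), ← map_mul]
    norm_num
  have hc : ∀ i : Fin (2 * g + 1),
      curveSeq g (curvePolys 𝕜 g) (2 * g - (i : ℕ)) = curvePolys 𝕜 g i := by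
    intro i
    have := curveSeq_val g (curvePolys 𝕜 g) (Fin.rev i)
    rw [Fin.rev_rev, Fin.val_rev] at this
    rw [← this]
    congr 1
    omega
  have hprev : MvPolynomial.eval v (MvPolynomial.mkDerivation 𝕜 (fun m => MvPolynomial.C (ξ m))
      (curveSeq g (curvePolys 𝕜 g) (2 * g - (j : ℕ) + 1))) = if j = 0 then 0 else w (j - 1) := by
    split_ifs with hj
    · subst hj
      rw [curveSeq_of_le g _ (by simp), map_zero, map_zero]
    · have hj' : ((j - 1 : Fin (2 * g + 1)) : ℕ) = j - 1 := Fin.val_sub_one_of_ne_zero hj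
      have hpos : (j : ℕ) ≠ 0 := fun h => hj (Fin.ext h)
      rw [show 2 * g - (j : ℕ) + 1 = 2 * g - ((j - 1 : Fin (2 * g + 1)) : ℕ) by omega, hc, hDx]
  have key := congrArg (MvPolynomial.eval v) (flowDerivation_one_curveSeq hg ξ (2 * g - (j : ℕ)))
  rw [map_sub, map_sub, hprev, hc, eval_derivation] at key
  simp only [eval_flowDerivation_X] at key
  rw [fderiv_polyMap_apply]
  refine key.trans ?_
  rw [hroot', Derivation.leibniz, MvPolynomial.derivation_C, smul_zero, add_zero, smul_eq_mul]
  simp only [map_mul, map_ofNat, MvPolynomial.eval_C, hu, hDx]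
  ring

end FirstFlow

/-! ### Commuting evolutionary systems -/

section Commute

variable {𝕜 : Type*} [RCLike 𝕜] {n : ℕ}

lemma ContDiffOn.hasDerivAt_deriv {E : Type*} [NormedAddCommGroup E] [NormedSpace 𝕜 E]
    {I : Set 𝕜} {q : 𝕜 → E} (hI : IsOpen I) (hq : ContDiffOn 𝕜 2 q I) {y : 𝕜} (hy : y ∈ I) :
    HasDerivAt q (deriv q y) y ∧ HasDerivAt (deriv q) (deriv (deriv q) y) y := by
  refine ⟨((hq.differentiableOn two_ne_zero).differentiableAt (hI.mem_nhds hy)).hasDerivAt, ?_⟩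
  have h : ContDiffOn 𝕜 1 (deriv q) I := hq.deriv_of_isOpen hI (by norm_num)
  exact ((h.differentiableOn one_ne_zero).differentiableAt (hI.mem_nhds hy)).hasDerivAt

/-- Hamilton–Jacobi systems with commuting Jacobians commute. -/
lemma systemsCommute_hj {F G : Fin (n + 1) → MvPolynomial (Fin (n + 1)) 𝕜}
    (hFG : ∀ v ξ, fderiv 𝕜 (polyMap F) v (fderiv 𝕜 (polyMap G) v ξ)
      = fderiv 𝕜 (polyMap G) v (fderiv 𝕜 (polyMap F) v ξ)) :
    SystemsCommute (hjRHS F) (hjRHS G) := by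
  have key : ∀ (A B : Fin (n + 1) → MvPolynomial (Fin (n + 1)) 𝕜) (I : Set 𝕜)
      (q : 𝕜 → Fin (n + 1) → 𝕜), IsOpen I → ContDiffOn 𝕜 2 q I → ∀ y ∈ I,
      linearizedRHS (hjRHS A) q (fun s => hjRHS B (q s, deriv q s)) y
        = fderiv 𝕜 (polyMap A) (deriv q y)
          (fderiv 𝕜 (polyMap B) (deriv q y) (deriv (deriv q) y)) := by
    intro A B I q hI hq y hy
    obtain ⟨-, h2⟩ := hq.hasDerivAt_deriv hI hy
    have hA : HasFDerivAt (hjRHS A) ((fderiv 𝕜 (polyMap A) (deriv q y)).comp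
        (ContinuousLinearMap.snd 𝕜 (Fin (n + 1) → 𝕜) (Fin (n + 1) → 𝕜))) (q y, deriv q y) :=
      HasFDerivAt.comp (g := polyMap A) (q y, deriv q y)
        ((differentiable_polyMap A) (deriv q y)).hasFDerivAt hasFDerivAt_snd
    have hB : HasDerivAt (fun s => hjRHS B (q s, deriv q s))
        (fderiv 𝕜 (polyMap B) (deriv q y) (deriv (deriv q) y)) y :=
      HasFDerivAt.comp_hasDerivAt (l := polyMap B) y
        ((differentiable_polyMap B) (deriv q y)).hasFDerivAt h2
    rw [linearizedRHS, hA.fderiv, hB.deriv]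
    rfl
  intro I q hI hq y hy
  rw [key F G I q hI hq y hy, key G F I q hI hq y hy, hFG]

lemma consRHS_eq (F : Fin (n + 1) → MvPolynomial (Fin (n + 1)) 𝕜)
    (v w : Fin (n + 1) → 𝕜) : consRHS F (v, w) = fderiv 𝕜 (polyMap F) v w := by
  rw [fderiv_polyMap_eq_mulVec]
  rfl

lemma differentiable_fderiv_polyMap (F : Fin (n + 1) → MvPolynomial (Fin (n + 1)) 𝕜) :
    Differentiable 𝕜 (fderiv 𝕜 (polyMap F)) :=
  ((contDiff_polyMap F (m := 2)).fderiv_right (m := 1) (by norm_num)).differentiable one_ne_zero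

lemma fderiv_fderiv_polyMap_symm (F : Fin (n + 1) → MvPolynomial (Fin (n + 1)) 𝕜)
    (v a b : Fin (n + 1) → 𝕜) :
    fderiv 𝕜 (fderiv 𝕜 (polyMap F)) v a b = fderiv 𝕜 (fderiv 𝕜 (polyMap F)) v b a :=
  (contDiff_polyMap F (m := 2)).contDiffAt.isSymmSndFDerivAt
    (by rw [minSmoothness_of_isRCLikeNormedField]; rfl) a b

lemma hasFDerivAt_fderiv_polyMap_apply (F : Fin (n + 1) → MvPolynomial (Fin (n + 1)) 𝕜)
    (v w : Fin (n + 1) → 𝕜) :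
    HasFDerivAt (fun p : (Fin (n + 1) → 𝕜) × (Fin (n + 1) → 𝕜) => fderiv 𝕜 (polyMap F) p.1 p.2)
      ((fderiv 𝕜 (polyMap F) v).comp (ContinuousLinearMap.snd 𝕜 (Fin (n + 1) → 𝕜) (Fin (n + 1) → 𝕜))
        + ((fderiv 𝕜 (fderiv 𝕜 (polyMap F)) v).comp
          (ContinuousLinearMap.fst 𝕜 (Fin (n + 1) → 𝕜) (Fin (n + 1) → 𝕜))).flip w)
      (v, w) :=
  HasFDerivAt.clm_apply
    (HasFDerivAt.comp (g := fderiv 𝕜 (polyMap F)) (v, w)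
      (differentiable_fderiv_polyMap F v).hasFDerivAt hasFDerivAt_fst) hasFDerivAt_snd

lemma hasFDerivAt_consRHS (F : Fin (n + 1) → MvPolynomial (Fin (n + 1)) 𝕜)
    (v w : Fin (n + 1) → 𝕜) :
    HasFDerivAt (consRHS F)
      ((fderiv 𝕜 (polyMap F) v).comp (ContinuousLinearMap.snd 𝕜 (Fin (n + 1) → 𝕜) (Fin (n + 1) → 𝕜))
        + ((fderiv 𝕜 (fderiv 𝕜 (polyMap F)) v).comp
          (ContinuousLinearMap.fst 𝕜 (Fin (n + 1) → 𝕜) (Fin (n + 1) → 𝕜))).flip w)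
      (v, w) := by
  have e : consRHS F = fun p => fderiv 𝕜 (polyMap F) p.1 p.2 :=
    funext fun p => consRHS_eq F p.1 p.2
  rw [e]
  exact hasFDerivAt_fderiv_polyMap_apply F v w

/-- Systems of conservation laws whose flux maps have commuting Jacobians commute: the two mixed
derivatives are the derivatives of `F'(q) G'(q) q_x` and of `G'(q) F'(q) q_x`. -/
lemma systemsCommute_cons {F G : Fin (n + 1) → MvPolynomial (Fin (n + 1)) 𝕜}
    (hFG : ∀ v ξ, fderiv 𝕜 (polyMap F) v (fderiv 𝕜 (polyMap G) v ξ)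
      = fderiv 𝕜 (polyMap G) v (fderiv 𝕜 (polyMap F) v ξ)) :
    SystemsCommute (consRHS F) (consRHS G) := by
  have key : ∀ (A B : Fin (n + 1) → MvPolynomial (Fin (n + 1)) 𝕜) (I : Set 𝕜)
      (q : 𝕜 → Fin (n + 1) → 𝕜), IsOpen I → ContDiffOn 𝕜 2 q I → ∀ y ∈ I,
      HasDerivAt (fun s => fderiv 𝕜 (polyMap A) (q s) (fderiv 𝕜 (polyMap B) (q s) (deriv q s)))
        (linearizedRHS (consRHS A) q (fun s => consRHS B (q s, deriv q s)) y) y := by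
    intro A B I q hI hq y hy
    obtain ⟨h1, h2⟩ := hq.hasDerivAt_deriv hI hy
    have hB := (hasFDerivAt_fderiv_polyMap_apply B (q y) (deriv q y)).comp_hasDerivAt y
      (h1.prodMk h2)
    have hA := (hasFDerivAt_fderiv_polyMap_apply A (q y)
      (fderiv 𝕜 (polyMap B) (q y) (deriv q y))).comp_hasDerivAt y (h1.prodMk hB)
    simp only [consRHS_eq, linearizedRHS]
    rw [(hasFDerivAt_consRHS A (q y) (deriv q y)).fderiv]
    have hd : deriv (fun s => fderiv 𝕜 (polyMap B) (q s) (deriv q s)) y = _ := hB.deriv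
    rw [hd]
    refine hA.congr_deriv ?_
    simp [fderiv_fderiv_polyMap_symm A (q y) (deriv q y)]
  intro I q hI hq y hy
  have hF := key F G I q hI hq y hy
  simp only [hFG] at hF
  exact hF.unique (key G F I q hI hq y hy)

/-- The change of variables `u = Φ(v)` acts on linearizations by the chain rule, up to a term that
is symmetric in the two variations. -/
lemma linearizedRHS_transport {K L K' L' : (Fin (n + 1) → 𝕜) × (Fin (n + 1) → 𝕜) → Fin (n + 1) → 𝕜}
    {Φ : Fin (n + 1) → MvPolynomial (Fin (n + 1)) 𝕜}
    (hK : Differentiable 𝕜 K) (hL : Differentiable 𝕜 L) (hK' : Differentiable 𝕜 K')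
    (hKK' : ∀ v w, K' (polyMap Φ v, fderiv 𝕜 (polyMap Φ) v w) = fderiv 𝕜 (polyMap Φ) v (K (v, w)))
    (hLL' : ∀ v w, L' (polyMap Φ v, fderiv 𝕜 (polyMap Φ) v w) = fderiv 𝕜 (polyMap Φ) v (L (v, w)))
    {I : Set 𝕜} {v : 𝕜 → Fin (n + 1) → 𝕜} (hI : IsOpen I) (hv : ContDiffOn 𝕜 2 v I) {y : 𝕜}
    (hy : y ∈ I) :
    linearizedRHS K' (fun s => polyMap Φ (v s))
        (fun s => L' (polyMap Φ (v s), deriv (fun s => polyMap Φ (v s)) s)) y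
      = fderiv 𝕜 (fderiv 𝕜 (polyMap Φ)) (v y) (L (v y, deriv v y)) (K (v y, deriv v y))
        + fderiv 𝕜 (polyMap Φ) (v y) (linearizedRHS K v (fun s => L (v s, deriv v s)) y) := by
  obtain ⟨h1, h2⟩ := hv.hasDerivAt_deriv hI hy
  have hderiv : ∀ s ∈ I, deriv (fun s => polyMap Φ (v s)) s
      = fderiv 𝕜 (polyMap Φ) (v s) (deriv v s) := fun s hs =>
    ((differentiable_polyMap Φ (v s)).hasFDerivAt.comp_hasDerivAt s
      (hv.hasDerivAt_deriv hI hs).1).deriv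
  have hφ := (hL (v y, deriv v y)).hasFDerivAt.comp_hasDerivAt y (h1.prodMk h2)
  set φ : 𝕜 → Fin (n + 1) → 𝕜 := fun s => L (v s, deriv v s)
  have hφ' : HasDerivAt φ (deriv φ y) y := hφ.differentiableAt.hasDerivAt
  have hev : (fun s => L' (polyMap Φ (v s), deriv (fun s => polyMap Φ (v s)) s))
      =ᶠ[nhds y] fun s => fderiv 𝕜 (polyMap Φ) (v s) (φ s) := by
    filter_upwards [hI.mem_nhds hy] with s hs
    rw [hderiv s hs, hLL']
  have hψ := (hasFDerivAt_fderiv_polyMap_apply Φ (v y) (φ y)).comp_hasDerivAt y (h1.prodMk hφ')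
  have hψ' : deriv (fun s => fderiv 𝕜 (polyMap Φ) (v s) (φ s)) y = _ := hψ.deriv
  -- the identity `K' ∘ (Φ, Φ') = Φ' K` is differentiated in the direction `(φ, φ_x)`
  have hG : HasFDerivAt (fun p : (Fin (n + 1) → 𝕜) × (Fin (n + 1) → 𝕜) =>
      (polyMap Φ p.1, fderiv 𝕜 (polyMap Φ) p.1 p.2)) _ (v y, deriv v y) :=
    (HasFDerivAt.comp (g := polyMap Φ) (v y, deriv v y)
      (differentiable_polyMap Φ (v y)).hasFDerivAt hasFDerivAt_fst).prodMk
      (hasFDerivAt_fderiv_polyMap_apply Φ (v y) (deriv v y))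
  have hleft := HasFDerivAt.comp (g := K') (v y, deriv v y)
    (hK' (polyMap Φ (v y), fderiv 𝕜 (polyMap Φ) (v y) (deriv v y))).hasFDerivAt hG
  have hright := HasFDerivAt.clm_apply
    (HasFDerivAt.comp (g := fderiv 𝕜 (polyMap Φ)) (v y, deriv v y)
      (differentiable_fderiv_polyMap Φ (v y)).hasFDerivAt hasFDerivAt_fst)
    (hK (v y, deriv v y)).hasFDerivAt
  have e : (K' ∘ fun p : (Fin (n + 1) → 𝕜) × (Fin (n + 1) → 𝕜) =>
      (polyMap Φ p.1, fderiv 𝕜 (polyMap Φ) p.1 p.2))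
      = fun p => (fderiv 𝕜 (polyMap Φ) ∘ Prod.fst) p (K p) :=
    funext fun p => hKK' p.1 p.2
  rw [e] at hleft
  have := congrArg (· (φ y, deriv φ y)) (hleft.unique hright)
  simp only [linearizedRHS]
  rw [hderiv y hy, hev.deriv_eq, hψ', hLL', ← show φ y = L (v y, deriv v y) from rfl]
  simp at this ⊢
  rw [fderiv_fderiv_polyMap_symm Φ (v y) (deriv v y), this]
  abel

lemma SystemsCommute.transport
    {K L K' L' : (Fin (n + 1) → 𝕜) × (Fin (n + 1) → 𝕜) → Fin (n + 1) → 𝕜}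
    {Φ Ψ : Fin (n + 1) → MvPolynomial (Fin (n + 1)) 𝕜}
    (hΦΨ : ∀ u, polyMap Φ (polyMap Ψ u) = u)
    (hK : Differentiable 𝕜 K) (hL : Differentiable 𝕜 L)
    (hK' : Differentiable 𝕜 K') (hL' : Differentiable 𝕜 L')
    (hKK' : ∀ v w, K' (polyMap Φ v, fderiv 𝕜 (polyMap Φ) v w) = fderiv 𝕜 (polyMap Φ) v (K (v, w)))
    (hLL' : ∀ v w, L' (polyMap Φ v, fderiv 𝕜 (polyMap Φ) v w) = fderiv 𝕜 (polyMap Φ) v (L (v, w)))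
    (h : SystemsCommute K L) : SystemsCommute K' L' := by
  intro I u hI hu y hy
  obtain ⟨v, hv, rfl⟩ : ∃ v : 𝕜 → Fin (n + 1) → 𝕜, ContDiffOn 𝕜 2 v I ∧
      u = fun s => polyMap Φ (v s) :=
    ⟨fun s => polyMap Ψ (u s), (contDiff_polyMap Ψ (m := 2)).comp_contDiffOn hu,
      funext fun s => (hΦΨ (u s)).symm⟩
  rw [linearizedRHS_transport hK hL hK' hKK' hLL' hI hv hy,
    linearizedRHS_transport hL hK hL' hLL' hKK' hI hv hy, h I v hI hv y hy,
    fderiv_fderiv_polyMap_symm]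

lemma differentiable_consRHS (F : Fin (n + 1) → MvPolynomial (Fin (n + 1)) 𝕜) :
    Differentiable 𝕜 (consRHS F) :=
  fun p => (hasFDerivAt_consRHS F p.1 p.2).differentiableAt

lemma differentiable_hydroRHS
    (V : Matrix (Fin (n + 1)) (Fin (n + 1)) (MvPolynomial (Fin (n + 1)) 𝕜)) :
    Differentiable 𝕜 (hydroRHS V) := by
  refine differentiable_pi.2 fun j => ?_
  refine Differentiable.fun_sum fun l _ => Differentiable.mul ?_ ?_
  · exact ((contDiff_eval (V j l) (m := 1)).differentiable one_ne_zero).comp differentiable_fst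
  · exact (ContinuousLinearMap.proj (R := 𝕜) (φ := fun _ : Fin (n + 1) => 𝕜) l).differentiable.comp
      differentiable_snd

end Commute

/-! ### Closed one-forms and their primitives -/

section Forms

variable {𝕜 : Type*} [RCLike 𝕜] {n : ℕ}

lemma isClosedFormOn_of_primitive {ω : (Fin n → 𝕜) → ((Fin n → 𝕜) →L[𝕜] 𝕜)}
    {S : (Fin n → 𝕜) → 𝕜} {O : Set (Fin n → 𝕜)} (hO : IsOpen O) (hS : ContDiffOn 𝕜 2 S O)
    (h : ∀ y ∈ O, HasFDerivAt S (ω y) y) : IsClosedFormOn ω O := by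
  intro x hx a b
  have hev : ω =ᶠ[nhds x] fderiv 𝕜 S := by
    filter_upwards [hO.mem_nhds hx] with y hy using (h y hy).fderiv.symm
  rw [hev.fderiv_eq, sub_eq_zero]
  exact (hS.contDiffAt (hO.mem_nhds hx)).isSymmSndFDerivAt
    (by rw [minSmoothness_of_isRCLikeNormedField]) a b

/-- A closed continuously differentiable one-form has a primitive near every point. -/
lemma IsClosedFormOn.exists_primitive {ω : (Fin n → 𝕜) → ((Fin n → 𝕜) →L[𝕜] 𝕜)}
    {O : Set (Fin n → 𝕜)} (hO : IsOpen O) (hconv : Convex ℝ O) (hω : ContDiffOn 𝕜 1 ω O)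
    (hclosed : IsClosedFormOn ω O) :
    ∃ S : (Fin n → 𝕜) → 𝕜, ContDiffOn 𝕜 2 S O ∧ ∀ y ∈ O, HasFDerivAt S (ω y) y := by
  have hd : DifferentiableOn 𝕜 ω O := hω.differentiableOn one_ne_zero
  obtain ⟨S, hS⟩ := hconv.exists_forall_hasFDerivAt_of_fderiv_symmetric hO
    (hd.restrictScalars ℝ) (fun a ha x y => by
      rw [(hd.differentiableAt (hO.mem_nhds ha)).fderiv_restrictScalars ℝ]
      exact sub_eq_zero.1 (hclosed a ha x y))
  refine ⟨S, ?_, hS⟩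
  rw [show (2 : WithTop ℕ∞) = 1 + 1 by norm_num, contDiffOn_succ_iff_fderiv_of_isOpen hO]
  refine ⟨fun y hy => (hS y hy).differentiableAt.differentiableWithinAt, by simp, ?_⟩
  exact hω.congr fun y hy => (hS y hy).fderiv

end Forms

/-! ### The equivalence of the systems -/

section Equivalence

variable {𝕜 : Type*} [RCLike 𝕜] {n : ℕ}

lemma partialD_component {v : (Fin n → 𝕜) → Fin n → 𝕜} {x : Fin n → 𝕜}
    (hv : DifferentiableAt 𝕜 v x) (k i : Fin n) :
    partialD k (fun y => v y i) x = fderiv 𝕜 v x (Pi.single k 1) i := by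
  have h := (ContinuousLinearMap.proj (R := 𝕜) (φ := fun _ : Fin n => 𝕜) i).hasFDerivAt.comp x
    hv.hasFDerivAt
  have h' : fderiv 𝕜 (fun y => v y i) x = _ := h.fderiv
  rw [partialD, h']
  rfl

lemma fderiv_eval_comp {v : (Fin n → 𝕜) → Fin n → 𝕜} {x : Fin n → 𝕜}
    (hv : DifferentiableAt 𝕜 v x) (p : MvPolynomial (Fin n) 𝕜) (a : Fin n → 𝕜) :
    fderiv 𝕜 (fun y => MvPolynomial.eval (v y) p) x a
      = fderiv 𝕜 (fun v => MvPolynomial.eval v p) (v x) (fderiv 𝕜 v x a) := by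
  have h := (hasFDerivAt_eval p (v x)).differentiableAt.hasFDerivAt.comp x hv.hasFDerivAt
  have h' : fderiv 𝕜 (fun y => MvPolynomial.eval (v y) p) x = _ := h.fderiv
  rw [h']
  rfl

lemma solvesConsLaw_iff {k : Fin (n + 1)} {F : Fin (n + 1) → MvPolynomial (Fin (n + 1)) 𝕜}
    {U : Set (Fin (n + 1) → 𝕜)} {v : (Fin (n + 1) → 𝕜) → Fin (n + 1) → 𝕜}
    (hv : ∀ x ∈ U, DifferentiableAt 𝕜 v x) :
    SolvesConsLaw k F U v ↔ ∀ x ∈ U, fderiv 𝕜 v x (Pi.single k 1)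
      = fderiv 𝕜 (polyMap F) (v x) (fderiv 𝕜 v x (Pi.single 0 1)) := by
  refine forall₂_congr fun x hx => ?_
  rw [funext_iff]
  refine forall_congr' fun i => ?_
  rw [partialD_component (hv x hx), partialD, fderiv_eval_comp (hv x hx), fderiv_polyMap_apply]

lemma solvesHydro_iff {k : Fin (n + 1)}
    {V : Matrix (Fin (n + 1)) (Fin (n + 1)) (MvPolynomial (Fin (n + 1)) 𝕜)}
    {U : Set (Fin (n + 1) → 𝕜)} {u : (Fin (n + 1) → 𝕜) → Fin (n + 1) → 𝕜}
    (hu : ∀ x ∈ U, DifferentiableAt 𝕜 u x) :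
    SolvesHydro k V U u ↔ ∀ x ∈ U, fderiv 𝕜 u x (Pi.single k 1)
      = (V.map (MvPolynomial.eval (u x))).mulVec (fderiv 𝕜 u x (Pi.single 0 1)) := by
  refine forall₂_congr fun x hx => ?_
  rw [funext_iff]
  refine forall_congr' fun i => ?_
  simp only [partialD_component (hu x hx)]
  rfl

variable {g : ℕ}

lemma hydroMatrix_mulVec_curve (k : Fin (2 * g + 1)) (v w : Fin (2 * g + 1) → 𝕜) :
    ((hydroMatrix 𝕜 g k).map (MvPolynomial.eval (polyMap (curvePolys 𝕜 g) v))).mulVec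
        (fderiv 𝕜 (polyMap (curvePolys 𝕜 g)) v w)
      = fderiv 𝕜 (polyMap (curvePolys 𝕜 g)) v (fderiv 𝕜 (polyMap (tablePoly 𝕜 g k)) v w) := by
  rw [hydroMatrix_mulVec, fderiv_root_curve, root_curve]

/-- Each single system of conservation laws for `v` is equivalent to the system for `u(v)`: the
latter is the former multiplied by the invertible Jacobian of `v ↦ u`. -/
lemma solvesConsLaw_iff_solvesHydro {U : Set (Fin (2 * g + 1) → 𝕜)}
    {v : (Fin (2 * g + 1) → 𝕜) → Fin (2 * g + 1) → 𝕜} (hU : IsOpen U) (hv : ContDiffOn 𝕜 1 v U)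
    (k : Fin (2 * g + 1)) :
    SolvesConsLaw k (tablePoly 𝕜 g k) U v
      ↔ SolvesHydro k (hydroMatrix 𝕜 g k) U (fun x => curveCoeff g (v x)) := by
  have hvd : ∀ x ∈ U, DifferentiableAt 𝕜 v x := fun x hx =>
    (hv.differentiableOn one_ne_zero).differentiableAt (hU.mem_nhds hx)
  have e : (fun x => curveCoeff g (v x)) = fun x => polyMap (curvePolys 𝕜 g) (v x) :=
    funext fun x => (polyMap_curvePolys (v x)).symm
  have hD : ∀ x ∈ U, HasFDerivAt (fun x => polyMap (curvePolys 𝕜 g) (v x))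
      ((fderiv 𝕜 (polyMap (curvePolys 𝕜 g)) (v x)).comp (fderiv 𝕜 v x)) x := fun x hx =>
    (differentiable_polyMap (curvePolys 𝕜 g) (v x)).hasFDerivAt.comp x (hvd x hx).hasFDerivAt
  rw [e, solvesConsLaw_iff hvd, solvesHydro_iff fun x hx => (hD x hx).differentiableAt]
  refine forall₂_congr fun x hx => ?_
  rw [(hD x hx).fderiv, ContinuousLinearMap.comp_apply, ContinuousLinearMap.comp_apply,
    hydroMatrix_mulVec_curve]
  refine ⟨fun h => by rw [h], fun h => ?_⟩
  rw [← fderiv_root_curve (v x) (fderiv 𝕜 v x (Pi.single k 1)), h, fderiv_root_curve]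

lemma fderiv_tablePoly_zero (v w : Fin (2 * g + 1) → 𝕜) :
    fderiv 𝕜 (polyMap (tablePoly 𝕜 g 0)) v w = w := by
  have e : polyMap (tablePoly 𝕜 g 0) = id := funext fun v => funext fun i => eval_tablePoly_zero v i
  rw [e, fderiv_id]
  rfl

lemma eval_tablePoly_baseCoords {H : ℕ → ℕ → 𝕜} (hH : H ∈ Wgc 𝕜 g) (k i : Fin (2 * g + 1)) :
    H k i = MvPolynomial.eval (baseCoords g H) (tablePoly 𝕜 g k i) := by
  rw [tablePoly, eval_table_genericRoot, ← eq_tableOf_of_mem_Wgc hH]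

lemma omegaForm_single (H : (Fin (2 * g + 1) → 𝕜) → ℕ → ℕ → 𝕜) (i k : Fin (2 * g + 1))
    (x : Fin (2 * g + 1) → 𝕜) : omegaForm g H i x (Pi.single k 1) = H x k i := by
  simp [omegaForm, Pi.single_apply]

namespace IsWgcFamily

variable {U : Set (Fin (2 * g + 1) → 𝕜)} {H : (Fin (2 * g + 1) → 𝕜) → ℕ → ℕ → 𝕜}

lemma contDiffOn_baseCoords (hH : IsWgcFamily g U H) :
    ContDiffOn 𝕜 1 (fun x => baseCoords g (H x)) U :=
  contDiffOn_pi.2 fun i => hH.contDiffOn 0 i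

lemma contDiffOn_omegaForm (hH : IsWgcFamily g U H) (i : Fin (2 * g + 1)) :
    ContDiffOn 𝕜 1 (omegaForm g H i) U :=
  ContDiffOn.sum fun k _ => (hH.contDiffOn k i).smul contDiffOn_const

lemma fderiv_omegaForm (hU : IsOpen U) (hH : IsWgcFamily g U H) (i : Fin (2 * g + 1))
    {x : Fin (2 * g + 1) → 𝕜} (hx : x ∈ U) (a b : Fin (2 * g + 1) → 𝕜) :
    fderiv 𝕜 (omegaForm g H i) x a b = ∑ k : Fin (2 * g + 1), b k *
      fderiv 𝕜 (polyMap (tablePoly 𝕜 g k)) (baseCoords g (H x))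
        (fderiv 𝕜 (fun x => baseCoords g (H x)) x a) i := by
  have hd : ∀ k : Fin (2 * g + 1), HasFDerivAt (fun x => H x k i)
      (fderiv 𝕜 (fun x => H x k i) x) x := fun k =>
    (((hH.contDiffOn k i).differentiableOn one_ne_zero).differentiableAt
      (hU.mem_nhds hx)).hasFDerivAt
  have hv : DifferentiableAt 𝕜 (fun x => baseCoords g (H x)) x :=
    (hH.contDiffOn_baseCoords.differentiableOn one_ne_zero).differentiableAt (hU.mem_nhds hx)
  have hω : HasFDerivAt (omegaForm g H i) _ x :=
    HasFDerivAt.fun_sum fun k _ => (hd k).smul_const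
      (ContinuousLinearMap.proj k : (Fin (2 * g + 1) → 𝕜) →L[𝕜] 𝕜)
  rw [hω.fderiv]
  simp only [sum_apply, ContinuousLinearMap.smulRight_apply,
    smul_apply, ContinuousLinearMap.proj_apply, smul_eq_mul]
  refine Finset.sum_congr rfl fun k _ => ?_
  have hev : (fun x => H x k i) =ᶠ[nhds x]
      fun x => MvPolynomial.eval (baseCoords g (H x)) (tablePoly 𝕜 g k i) := by
    filter_upwards [hU.mem_nhds hx] with y hy using eval_tablePoly_baseCoords (hH.mem y hy) k i
  rw [hev.fderiv_eq, fderiv_eval_comp hv, fderiv_polyMap_apply, mul_comm]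

/-- The closedness of the forms `ω_i` is equivalent to the systems of conservation laws.  The
equations `∂_k H^l_i = ∂_l H^k_i` with `k` and `l` both nonzero follow from those with `l = 0` since
the Jacobians of the flux maps commute. -/
lemma isIntegrableFamily_iff (hU : IsOpen U) (hH : IsWgcFamily g U H) :
    IsIntegrableFamily g U H ↔ ∀ k, k ≠ 0 →
      SolvesConsLaw k (tablePoly 𝕜 g k) U (fun x => baseCoords g (H x)) := by
  have hv : ∀ x ∈ U, DifferentiableAt 𝕜 (fun x => baseCoords g (H x)) x := fun x hx =>
    (hH.contDiffOn_baseCoords.differentiableOn one_ne_zero).differentiableAt (hU.mem_nhds hx)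
  constructor
  · intro h k _
    rw [solvesConsLaw_iff hv]
    intro x hx
    funext i
    have := h i x hx (Pi.single k 1) (Pi.single 0 1)
    rw [hH.fderiv_omegaForm hU i hx, hH.fderiv_omegaForm hU i hx] at this
    simp only [Pi.single_apply, ite_mul, one_mul, zero_mul, Finset.sum_ite_eq', Finset.mem_univ,
      if_true, fderiv_tablePoly_zero] at this
    exact sub_eq_zero.1 this
  · intro h i x hx a b
    set v := baseCoords g (H x) with hvdef
    set D := fderiv 𝕜 (fun x => baseCoords g (H x)) x with hD
    have hk : ∀ k, D (Pi.single k 1)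
        = fderiv 𝕜 (polyMap (tablePoly 𝕜 g k)) v (D (Pi.single 0 1)) := by
      intro k
      by_cases hk : k = 0
      · rw [hk, fderiv_tablePoly_zero]
      · exact (solvesConsLaw_iff hv).1 (h k hk) x hx
    have hexp : ∀ a : Fin (2 * g + 1) → 𝕜, D a
        = ∑ l, a l • fderiv 𝕜 (polyMap (tablePoly 𝕜 g l)) v (D (Pi.single 0 1)) := by
      intro a
      conv_lhs => rw [pi_eq_sum_univ' a]
      rw [map_sum]
      refine Finset.sum_congr rfl fun l _ => ?_
      rw [map_smul, ← hk]
    rw [hH.fderiv_omegaForm hU i hx, hH.fderiv_omegaForm hU i hx, sub_eq_zero, ← hD, ← hvdef,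
      hexp a, hexp b]
    simp only [map_sum, map_smul, Finset.sum_apply, Pi.smul_apply, smul_eq_mul, Finset.mul_sum]
    rw [Finset.sum_comm]
    refine Finset.sum_congr rfl fun l _ => Finset.sum_congr rfl fun k _ => ?_
    rw [fderiv_tablePoly_comm k l]
    ring

lemma partialD_eq_eval (hH : IsWgcFamily g U H)
    {S : Fin (2 * g + 1) → (Fin (2 * g + 1) → 𝕜) → 𝕜} {x : Fin (2 * g + 1) → 𝕜} (hx : x ∈ U)
    (hS : ∀ i, HasFDerivAt (S i) (omegaForm g H i x) x) (k i : Fin (2 * g + 1)) :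
    partialD k (S i) x
      = MvPolynomial.eval (fun l => partialD 0 (S l) x) (tablePoly 𝕜 g k i) := by
  have h : ∀ k i, partialD k (S i) x = H x k i := by
    intro k i
    rw [partialD, (hS i).fderiv, omegaForm_single]
  rw [h, eval_tablePoly_baseCoords (hH.mem x hx)]
  congr 2
  funext l
  rw [h]
  rfl

lemma isIntegrableFamily_iff_exists_primitive (hU : IsOpen U) (hH : IsWgcFamily g U H) :
    IsIntegrableFamily g U H ↔
      ∀ x ∈ U, ∃ O ⊆ U, IsOpen O ∧ x ∈ O ∧
        ∃ S : Fin (2 * g + 1) → (Fin (2 * g + 1) → 𝕜) → 𝕜,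
          (∀ i, ContDiffOn 𝕜 2 (S i) O) ∧
          (∀ i, ∀ y ∈ O, HasFDerivAt (S i) (omegaForm g H i y) y) ∧
          ∀ k, k ≠ 0 → SolvesHJ k (tablePoly 𝕜 g k) O S := by
  constructor
  · intro h x hx
    obtain ⟨ε, hε, hball⟩ := Metric.isOpen_iff.1 hU x hx
    have hprim := fun i => IsClosedFormOn.exists_primitive Metric.isOpen_ball (convex_ball x ε)
      ((hH.contDiffOn_omegaForm i).mono hball) (fun y hy => h i y (hball hy))
    choose S hS hS' using hprim
    refine ⟨Metric.ball x ε, hball, Metric.isOpen_ball, Metric.mem_ball_self hε, S, hS, hS', ?_⟩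
    intro k _ y hy i
    exact hH.partialD_eq_eval (hball hy) (fun i => hS' i y hy) k i
  · intro h i x hx
    obtain ⟨O, -, hO, hxO, S, hS, hS', -⟩ := h x hx
    exact isClosedFormOn_of_primitive hO (hS i) (hS' i) x hxO

end IsWgcFamily

/-- A solution of the Hamilton–Jacobi systems is a family of primitives of the forms of the family
of points of `W_{gc}` with coordinates `v_l = ∂S_l/∂x_{2g+1}`. -/
lemma exists_family_of_solvesHJ {U : Set (Fin (2 * g + 1) → 𝕜)}
    {S : Fin (2 * g + 1) → (Fin (2 * g + 1) → 𝕜) → 𝕜} (hU : IsOpen U)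
    (hS : ∀ i, ContDiffOn 𝕜 2 (S i) U) (hHJ : ∀ k, k ≠ 0 → SolvesHJ k (tablePoly 𝕜 g k) U S) :
    ∃ H : (Fin (2 * g + 1) → 𝕜) → ℕ → ℕ → 𝕜,
      IsWgcFamily g U H ∧ IsIntegrableFamily g U H ∧
      ∀ i, ∀ x ∈ U, HasFDerivAt (S i) (omegaForm g H i x) x := by
  set v : (Fin (2 * g + 1) → 𝕜) → Fin (2 * g + 1) → 𝕜 := fun x l => partialD 0 (S l) x with hv
  have hvC : ContDiffOn 𝕜 1 v U := contDiffOn_pi.2 fun l =>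
    ((hS l).fderiv_of_isOpen hU (by norm_num)).clm_apply contDiffOn_const
  have hprim : ∀ i, ∀ x ∈ U, HasFDerivAt (S i)
      (omegaForm g (fun x => tableOf (rootSeq 𝕜 g (v x))) i x) x := by
    intro i x hx
    refine (((hS i).differentiableOn two_ne_zero).differentiableAt
      (hU.mem_nhds hx)).hasFDerivAt.congr_fderiv ?_
    refine ContinuousLinearMap.coe_injective (LinearMap.pi_ext' fun k => LinearMap.ext_ring ?_)
    change fderiv 𝕜 (S i) x (Pi.single k 1) = omegaForm g _ i x (Pi.single k 1)
    rw [omegaForm_single, ← eval_table_genericRoot]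
    change partialD k (S i) x = MvPolynomial.eval (v x) (tablePoly 𝕜 g k i)
    by_cases hk : k = 0
    · rw [hk, eval_tablePoly_zero]
    · exact hHJ k hk x hx i
  refine ⟨fun x => tableOf (rootSeq 𝕜 g (v x)), ⟨fun x _ => tableOf_rootSeq_mem g (v x), ?_⟩,
    fun i => isClosedFormOn_of_primitive hU (hS i) (hprim i), hprim⟩
  intro j s
  simp only [← eval_table_genericRoot]
  exact (contDiff_eval (tableOf (genericRoot 𝕜 g) j s) (m := 1)).comp_contDiffOn hvC

end Equivalence

theorem mainTheorem4 (𝕜 : Type*) [RCLike 𝕜] (g : ℕ) (hg : 1 ≤ g) :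
    ∃ (F : Fin (2 * g + 1) → Fin (2 * g + 1) → MvPolynomial (Fin (2 * g + 1)) 𝕜)
      (V : Fin (2 * g + 1) →
        Matrix (Fin (2 * g + 1)) (Fin (2 * g + 1)) (MvPolynomial (Fin (2 * g + 1)) 𝕜)),
      -- points of `W_{gc}` are parameterized by `v`, the other coefficients are polynomials in `v`
      (∀ v : Fin (2 * g + 1) → 𝕜, ∃! H : ℕ → ℕ → 𝕜, H ∈ Wgc 𝕜 g ∧ baseCoords g H = v) ∧
      (∀ H ∈ Wgc 𝕜 g, ∀ k i : Fin (2 * g + 1),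
        H k i = MvPolynomial.eval (baseCoords g H) (F k i)) ∧
      -- the polynomials of the first system
      (∀ i : Fin (2 * g),
        F 1 i.castSucc = MvPolynomial.X i.succ - MvPolynomial.X 0 * MvPolynomial.X i.castSucc) ∧
      F 1 (Fin.last (2 * g)) =
        - MvPolynomial.C (1 / 2 : 𝕜) * (∑ a, MvPolynomial.X a * MvPolynomial.X (Fin.rev a))
          - MvPolynomial.X 0 * MvPolynomial.X (Fin.last (2 * g)) ∧
      -- every point of `W_{gc}` is the coordinate ring of the curve with coefficients `u`
      (∀ H ∈ Wgc 𝕜 g,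
        pSeries g H 0 ^ 2 =
          Polynomial.aeval (lamSeries 𝕜) (curvePoly g (curveCoeff g (baseCoords g H))) ∧
        (∀ j : ℕ, ∃ α : Polynomial 𝕜, α.Monic ∧ α.natDegree = j ∧
          pSeries g H j = Polynomial.aeval (lamSeries 𝕜) α * pSeries g H 0) ∧
        (Algebra.adjoin 𝕜 {lamSeries 𝕜, pSeries g H 0} : Set (LaurentSeries 𝕜))
          = pointSpace g H ∧
        ∃ e : CurveRing g (curveCoeff g (baseCoords g H)) ≃ₐ[𝕜]
            Algebra.adjoin 𝕜 {lamSeries 𝕜, pSeries g H 0},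
          (e (AdjoinRoot.of _ Polynomial.X) : LaurentSeries 𝕜) = lamSeries 𝕜 ∧
          (e (AdjoinRoot.root _) : LaurentSeries 𝕜) = pSeries g H 0) ∧
      -- closedness of the forms, Hamilton–Jacobi systems, conservation laws, systems for `u`
      (∀ (U : Set (Fin (2 * g + 1) → 𝕜)) (H : (Fin (2 * g + 1) → 𝕜) → ℕ → ℕ → 𝕜),
        IsOpen U → IsWgcFamily g U H →
        [IsIntegrableFamily g U H,
         ∀ x ∈ U, ∃ O ⊆ U, IsOpen O ∧ x ∈ O ∧
          ∃ S : Fin (2 * g + 1) → (Fin (2 * g + 1) → 𝕜) → 𝕜,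
            (∀ i, ContDiffOn 𝕜 2 (S i) O) ∧
            (∀ i, ∀ y ∈ O, HasFDerivAt (S i) (omegaForm g H i y) y) ∧
            ∀ k, k ≠ 0 → SolvesHJ k (F k) O S,
         ∀ k, k ≠ 0 → SolvesConsLaw k (F k) U (fun x => baseCoords g (H x)),
         ∀ k, k ≠ 0 →
          SolvesHydro k (V k) U (fun x => curveCoeff g (baseCoords g (H x)))].TFAE) ∧
      -- every solution of the Hamilton–Jacobi systems arises in this way
      (∀ (U : Set (Fin (2 * g + 1) → 𝕜)) (S : Fin (2 * g + 1) → (Fin (2 * g + 1) → 𝕜) → 𝕜),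
        IsOpen U → (∀ i, ContDiffOn 𝕜 2 (S i) U) →
        (∀ k, k ≠ 0 → SolvesHJ k (F k) U S) →
        ∃ H : (Fin (2 * g + 1) → 𝕜) → ℕ → ℕ → 𝕜,
          IsWgcFamily g U H ∧ IsIntegrableFamily g U H ∧
          ∀ i, ∀ x ∈ U, HasFDerivAt (S i) (omegaForm g H i x) x) ∧
      -- each single system of conservation laws is equivalent to the system for `u`
      (∀ (U : Set (Fin (2 * g + 1) → 𝕜)) (v : (Fin (2 * g + 1) → 𝕜) → Fin (2 * g + 1) → 𝕜),
        IsOpen U → ContDiffOn 𝕜 1 v U → ∀ k, k ≠ 0 →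
        (SolvesConsLaw k (F k) U v ↔ SolvesHydro k (V k) U (fun x => curveCoeff g (v x)))) ∧
      -- the first system for `u` is the dispersionless coupled KdV system
      (∀ (u w : Fin (2 * g + 1) → 𝕜) (j : Fin (2 * g + 1)),
        hydroRHS (V 1) (u, w) j =
          (if j = 0 then 0 else w (j - 1)) - (1 / 2) * u (Fin.last (2 * g)) * w j
            - u j * w (Fin.last (2 * g))) ∧
      -- pairwise commutativity
      (∀ k l : Fin (2 * g + 1), k ≠ 0 → l ≠ 0 →
        SystemsCommute (hjRHS (F k)) (hjRHS (F l)) ∧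
        SystemsCommute (consRHS (F k)) (consRHS (F l)) ∧
        SystemsCommute (hydroRHS (V k)) (hydroRHS (V l))) := by

  refine ⟨tablePoly 𝕜 g, hydroMatrix 𝕜 g, fun v => ?_, fun H hH k i =>
    eval_tablePoly_baseCoords hH k i, tablePoly_one_castSucc hg, tablePoly_one_last hg,
    fun H hH => ⟨pSeries_sq hH, exists_monic_mul_pSeries hH, adjoin_eq_pointSpace hH,
      exists_curveRing_equiv hH⟩, fun U H hU hH => ?_, fun U S hU hS hHJ =>
    exists_family_of_solvesHJ hU hS hHJ, fun U v hU hv k _ =>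
    solvesConsLaw_iff_solvesHydro hU hv k, hydroRHS_hydroMatrix_one hg, fun k l _ _ => ?_⟩
  · refine ⟨tableOf (rootSeq 𝕜 g v), ⟨tableOf_rootSeq_mem g v, baseCoords_tableOf g v⟩, ?_⟩
    rintro H ⟨hH, rfl⟩
    exact eq_tableOf_of_mem_Wgc hH
  · tfae_have 1 ↔ 2 := hH.isIntegrableFamily_iff_exists_primitive hU
    tfae_have 1 ↔ 3 := hH.isIntegrableFamily_iff hU
    tfae_have 3 ↔ 4 := forall₂_congr fun k _ =>
      solvesConsLaw_iff_solvesHydro hU hH.contDiffOn_baseCoords k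
    tfae_finish
  · have hcomm := fderiv_tablePoly_comm (𝕜 := 𝕜) (g := g) k l
    refine ⟨systemsCommute_hj hcomm, systemsCommute_cons hcomm, ?_⟩
    refine (systemsCommute_cons hcomm).transport (Φ := curvePolys 𝕜 g) (Ψ := rootPolys 𝕜 g)
      curve_root (differentiable_consRHS _) (differentiable_consRHS _) (differentiable_hydroRHS _)
      (differentiable_hydroRHS _) ?_ ?_ <;>
    · intro v w
      rw [consRHS_eq]
      exact hydroMatrix_mulVec_curve _ v w
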